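/- **Setting.** Dyadic intervals are the intervals $[k2^j,(k+1)2^j)$ with $j,k\in\mathbb Z$; $c(I)$ and $|I|$ denote the midpoint and the length of $I$, and $aI$ is the closed interval with midpoint $c(I)$ and length $a|I|$. Put $\tilde\chi_I(x)=\bigl(1+\operatorname{dist}(x,I)/|I|\bigr)^{-10}$. A tile is a product $P=I_P\times\omega_P$ of dyadic intervals with $|I_P||\omega_P|=1$; a tri-tile is $s=(I_s\times\omega_{s_1},I_s\times\omega_{s_2},I_s\times\omega_{s_3})$, each component being a tile; and $\omega_s=\omega_{s_1}\times\omega_{s_2}$ is its frequency square. For $C\in\mathbb R$ and $N\in\mathbb N$, a $C^N$ function $\psi:\mathbb R\to\mathbb C$ is *adapted to $I$ with constant $C$ and order $N$* if $|\psi^{(k)}(x)|\le C|I|^{-k}\tilde\chi_I(x)^N$ for all $x\in\mathbb R$ and $0\le k\le N$. For $a\ge 1$, a function $\phi$ is an ($L^2$-normalized) *wave packet for $P$ with parameters $(a,C,N)$* if - $x\mapsto |I_P|^{1/2}e^{-2\pi i c(\omega_P)x}\phi(x)$ is adapted to $I_P$ with constant $C$ and order $N$; - $\xi\mapsto|\omega_P|^{1/2}e^{2\pi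 i c(I_P)\xi}\hat\phi(\xi)$ is adapted to $\omega_P$ with constant $C$ and order $N$; - $\hat\phi$ vanishes outside $a\,\omega_P$. A *model* with parameters $(B,C,N)$ consists of a (finite or infinite) collection $\Omega$ of pairwise disjoint dyadic squares with sides parallel to the axes, a finite set $\mathbb S$ of tri-tiles with $\omega_s\in\Omega$ and $|c(\omega_{s_3})-c(\omega_{s_1})-c(\omega_{s_2})|\le B|\omega_{s_1}|$ for every $s\in\mathbb S$, and, for every $s\in\mathbb S$, wave packets $\phi_{s_1},\phi_{s_2},\phi_{s_3}$ for the three tiles of $s$, with parameters $(1,C,N)$, $(1,C,N)$ and $(\tfrac{11}{10},C,N)$ respectively. With $\langle u,v\rangle=\int_{\mathbb R}u\bar v$, its trilinear form is $$\Lambda(f,g,h)=\sum_{s\in\mathbb S}|I_s|^{-1/2}\langle f,\phi_{s_1}\rangle\langle g,\phi_{s_2}\rangle\langle h_{\omega_s},\phi_{s_3}\rangle,\qquad h=\{h_\omega\}_{\omega\in\Omega}.$$ **Proposition 1.3.** Let $2<r<\infty$ and $\frac1r+\frac1{r'}=1$. There are an order $N=N(r,p,q)$ and a constant $K=K(r,p,q,B,C)$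 with the following property. Let $F,G,H\subseteq\mathbb R$ be measurable sets of finite measure with $|H|=1$. Then there is a measurable set $H'\subseteq H$ with $|H'|>|H|/2$, which depends only on $r,F,G,H$, such that $$|\Lambda(f,g,h)|\le K\,|F|^{1/p}|G|^{1/q}|H|^{1/s'},\qquad \tfrac1{s'}=1-\tfrac1s,$$ for all exponents $r'<p,q<\infty$, $\frac{r'}2<s<r$ with $\frac1p+\frac1q=\frac1s$, for the form $\Lambda$ of every model with parameters $(B,C,N(r,p,q))$, and for all measurable $f$, $g$ and $h=\{h_\omega\}_{\omega\in\Omega}$ that satisfy, almost everywhere, $$|f|\le\mathbf 1_F,\qquad |g|\le\mathbf 1_G,\qquad \Bigl(\sum_{\omega\in\Omega}|h_\omega|^{r'}\Bigr)^{1/r'}\le\mathbf 1_{H'}.$$ -/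

import Mathlib

open MeasureTheory
open scoped ENNReal FourierTransform

namespace BilinearRdF

/-- The dyadic interval `[pos * 2 ^ scale, (pos + 1) * 2 ^ scale)`. -/
structure DyadicInterval where
  scale : ℤ
  pos : ℤ

namespace DyadicInterval

/-- The length `|I|`. -/
noncomputable def length (I : DyadicInterval) : ℝ := (2 : ℝ) ^ I.scale

/-- The midpoint of `I`. -/
noncomputable def center (I : DyadicInterval) : ℝ := ((I.pos : ℝ) + 1 / 2) * I.length

/-- The interval as a set of reals. -/
def toSet (I : DyadicInterval) : Set ℝ :=
  Set.Ico ((I.pos : ℝ) * I.length) (((I.pos : ℝ) + 1) * I.length)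

/-- The closed interval with the same midpoint as `I` and length `a * |I|`. -/
def dilate (a : ℝ) (I : DyadicInterval) : Set ℝ :=
  Metric.closedBall I.center (a * I.length / 2)

/-- The weight `(1 + dist (x, I) / |I|) ^ (-10)`. -/
noncomputable def chi (I : DyadicInterval) (x : ℝ) : ℝ :=
  (1 + Metric.infDist x I.toSet / I.length) ^ (-10 : ℤ)

theorem length_pos (I : DyadicInterval) : 0 < I.length := by
  unfold length; positivity

end DyadicInterval

/-- A dyadic square with sides parallel to the axes, in the frequency plane. -/
structure DyadicSquare where
  fst : DyadicInterval
  snd : DyadicInterval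
  length_eq : fst.length = snd.length

/-- The square as a subset of the plane. -/
def DyadicSquare.toSet (w : DyadicSquare) : Set (ℝ × ℝ) := w.fst.toSet ×ˢ w.snd.toSet

/-- A time-frequency tile: a product of two dyadic intervals, of area one. -/
structure Tile where
  space : DyadicInterval
  freq : DyadicInterval
  area : space.length * freq.length = 1

/-- A tri-tile: three tiles over the same spatial interval, indexed by `0, 1, 2`. -/
structure Tritile where
  space : DyadicInterval
  freq : Fin 3 → DyadicInterval
  area : ∀ j, space.length * (freq j).length = 1

namespace Tritile

/-- The `j`-th tile of a tri-tile. -/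
def tile (s : Tritile) (j : Fin 3) : Tile := ⟨s.space, s.freq j, s.area j⟩

/-- The frequency square, the product of the first two frequency intervals. -/
def square (s : Tritile) : DyadicSquare :=
  ⟨s.freq 0, s.freq 1,
    mul_left_cancel₀ s.space.length_pos.ne' ((s.area 0).trans (s.area 1).symm)⟩

/-- The third frequency interval is comparable to the sum of the first two, with constant `B`.
Its length is that of the first two, as all tiles have area one. -/
def ThirdComparable (B : ℝ) (s : Tritile) : Prop :=
  |(s.freq 2).center - ((s.freq 0).center + (s.freq 1).center)| ≤ B * (s.freq 0).length

end Tritile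

/-- The function `x ↦ exp (2 π i θ x) φ x`. -/
noncomputable def modulate (θ : ℝ) (φ : ℝ → ℂ) (x : ℝ) : ℂ :=
  Complex.exp (2 * Real.pi * Complex.I * θ * x) * φ x

/-- `φ` is adapted to the interval `I`, with constant `C`, up to order `N`. -/
def IsAdapted (C : ℝ) (N : ℕ) (I : DyadicInterval) (φ : ℝ → ℂ) : Prop :=
  ContDiff ℝ N φ ∧
    ∀ k ≤ N, ∀ x : ℝ, ‖iteratedDeriv k φ x‖ ≤ C * (I.length ^ k)⁻¹ * I.chi x ^ N

/-- `φ` is an `L²`-normalized wave packet for the tile `P`: it is adapted to the spatial interval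
(after translating its frequency to the origin), its Fourier transform is adapted to the frequency
interval (after translating its position to the origin), and the Fourier transform is supported in
the `a`-dilate of the frequency interval. -/
def IsWavePacket (a C : ℝ) (N : ℕ) (P : Tile) (φ : ℝ → ℂ) : Prop :=
  IsAdapted C N P.space
      (fun x => (Real.sqrt P.space.length : ℂ) * modulate (-P.freq.center) φ x) ∧
    IsAdapted C N P.freq
      (fun ξ => (Real.sqrt P.freq.length : ℂ) * modulate P.space.center (𝓕 φ) ξ) ∧
    Function.support (𝓕 φ) ⊆ P.freq.dilate a

/-- The dilation factors for the frequency supports of the three packets of a tri-tile. -/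
noncomputable def dilationFactor : Fin 3 → ℝ := ![1, 1, 11 / 10]

/-- The pairing `∫ f * conj φ`. -/
noncomputable def pairing (f φ : ℝ → ℂ) : ℂ := ∫ x, f x * starRingEnd ℂ (φ x)

/-- The trilinear model form
`∑ s ∈ S, |I_s| ^ (-1/2) * ⟨f, φ s 0⟩ * ⟨g, φ s 1⟩ * ⟨h_{ω_s}, φ s 2⟩`. -/
noncomputable def modelForm (S : Finset Tritile) (φ : Tritile → Fin 3 → ℝ → ℂ)
    (f g : ℝ → ℂ) (h : DyadicSquare → ℝ → ℂ) : ℂ :=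
  ∑ s ∈ S, ((s.space.length ^ (-(1 / 2) : ℝ) : ℝ) : ℂ) *
    pairing f (φ s 0) * pairing g (φ s 1) * pairing (h s.square) (φ s 2)

/-- `S` is a finite collection of tri-tiles and `φ` a choice of wave packets, as in the model
operator for the family of frequency squares `W`. -/
structure IsModel (B C : ℝ) (N : ℕ) (W : Set DyadicSquare) (S : Finset Tritile)
    (φ : Tritile → Fin 3 → ℝ → ℂ) : Prop where
  disjoint : W.PairwiseDisjoint DyadicSquare.toSet
  square_mem : ∀ s ∈ S, s.square ∈ W
  third : ∀ s ∈ S, s.ThirdComparable B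
  packet : ∀ s ∈ S, ∀ j, IsWavePacket (dilationFactor j) C N (s.tile j) (φ s j)

end BilinearRdF

/-! Normalize each coefficient by |I_s|^(-1/2), writing a_s, b_s, c_s for the absolute values; the
form is then at most ∑ |I_s| a_s b_s c_s. Hölder's inequality with exponents r and r' separates the
pair (f, g) from h. Comparability leaves only boundedly many offsets of the third frequency
interval, and once the offset is fixed a tri-tile is determined by I_s and its square.

Let E be the set where F or G is too dense, and H' = H \ E. The remoteness λ(I) = 1 + dist(c(I),
Eᶜ)/|I| measures how deep I lies in E. Coefficients of f and g may grow like λ, but h lives off E,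
so the packet decay gives the third coefficient a factor λ^(-3). Hölder is applied to a b λ^(-3) and
c λ^3.

For h (`sum_third_coefficients_le`), tri-tiles over one square have disjoint spatial intervals of
equal length, so their weights have a bounded sum and ∑ |I| (c λ^3)^r' is controlled by ∫ ∑ |h_ω|^r'
≤ 1.

For f and g (`exists_column_estimate`), sort by a_s ~ κ, κ a power of 2. The maximal first tiles of
a layer are disjoint and have comparable coefficients, so a TT* argument
(`sum_length_le_of_disjoint_tiles`) gives κ² ∑ |I_top| ≲ |F|. Below one top all first frequency
intervals meet, so disjointness of the squares passes to the second frequency intervals. The packets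
for g are therefore orthogonal across different second intervals, and a Bessel inequality localized
to the top (`sum_norm_pairing_sq_le_of_column`) applies. Because r > 2, the excess powers κ^(r-2)
b^(r-2), bounded pointwise by density, make the layers summable. When |F| ≤ |G| the resulting powers
of |F| and |G| are compared with 1/p and 1/q in `rpow_bound_le`; otherwise the roles of f and g are
exchanged. -/

namespace BilinearRdF

/-! ### Dyadic intervals and their polynomial weights -/

namespace DyadicInterval

theorem length_eq_iff {I J : DyadicInterval} : I.length = J.length ↔ I.scale = J.scale :=
  (zpow_right_strictMono₀ (one_lt_two : (1 : ℝ) < 2)).injective.eq_iff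

theorem length_le_iff {I J : DyadicInterval} : I.length ≤ J.length ↔ I.scale ≤ J.scale :=
  (zpow_right_strictMono₀ (one_lt_two : (1 : ℝ) < 2)).le_iff_le

theorem left_lt_right (I : DyadicInterval) :
    (I.pos : ℝ) * I.length < ((I.pos : ℝ) + 1) * I.length := by
  have := I.length_pos
  nlinarith

theorem toSet_injective : Function.Injective toSet := by
  intro I J h
  have h1 := (Set.Ico_subset_Ico_iff I.left_lt_right).1 h.subset
  have h2 := (Set.Ico_subset_Ico_iff J.left_lt_right).1 h.symm.subset
  have hl : I.length = J.length := by linarith [h1.1, h1.2, h2.1, h2.2]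
  have hp : (I.pos : ℝ) = J.pos := by
    have := le_antisymm h1.1 h2.1
    rw [hl] at this
    exact (mul_right_cancel₀ J.length_pos.ne' this).symm
  cases I; cases J
  simp only [mk.injEq]
  exact ⟨length_eq_iff.1 hl, by exact_mod_cast hp⟩

/-- Dyadic intervals are ordered by inclusion. -/
instance : PartialOrder DyadicInterval := PartialOrder.lift toSet toSet_injective

theorem le_def {I J : DyadicInterval} : I ≤ J ↔ I.toSet ⊆ J.toSet := Iff.rfl

theorem length_le_of_le {I J : DyadicInterval} (h : I ≤ J) : I.length ≤ J.length := by
  have := (Set.Ico_subset_Ico_iff I.left_lt_right).1 (le_def.1 h)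
  linarith [this.1, this.2]

/-- All endpoints are integer multiples of |I|, so the strict inequalities coming from a common
point round to the weak ones expressing inclusion. -/
theorem le_of_not_disjoint {I J : DyadicInterval} (hl : I.length ≤ J.length)
    (h : ¬ Disjoint I.toSet J.toSet) : I ≤ J := by
  obtain ⟨x, hI, hJ⟩ := Set.not_disjoint_iff.1 h
  obtain ⟨k, hk⟩ := Int.le.dest (length_le_iff.1 hl)
  have hJl : J.length = 2 ^ k * I.length := by
    unfold length
    rw [← hk, zpow_add₀ two_ne_zero, zpow_natCast, mul_comm]
  have hL := I.length_pos
  simp only [toSet, Set.mem_Ico, hJl] at hI hJ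
  have h1 : (I.pos : ℝ) < ((J.pos : ℝ) + 1) * 2 ^ k :=
    lt_of_mul_lt_mul_right (by nlinarith [hI.1, hJ.2]) hL.le
  have h2 : (J.pos : ℝ) * 2 ^ k < (I.pos : ℝ) + 1 :=
    lt_of_mul_lt_mul_right (by nlinarith [hI.2, hJ.1]) hL.le
  have h1' : I.pos < (J.pos + 1) * 2 ^ k := by exact_mod_cast h1
  have h2' : J.pos * 2 ^ k < I.pos + 1 := by exact_mod_cast h2
  have h1r : (I.pos : ℝ) + 1 ≤ ((J.pos : ℝ) + 1) * 2 ^ k := by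
    exact_mod_cast Int.add_one_le_iff.2 h1'
  have h2r : (J.pos : ℝ) * 2 ^ k ≤ (I.pos : ℝ) := by exact_mod_cast Int.lt_add_one_iff.1 h2'
  rw [le_def]
  refine Set.Ico_subset_Ico ?_ ?_
  · rw [hJl]; nlinarith
  · rw [hJl]; nlinarith

theorem eq_of_not_disjoint {I J : DyadicInterval} (hl : I.length = J.length)
    (h : ¬ Disjoint I.toSet J.toSet) : I = J :=
  le_antisymm (le_of_not_disjoint hl.le h) (le_of_not_disjoint hl.ge (fun h' => h h'.symm))

theorem left_mem (I : DyadicInterval) : (I.pos : ℝ) * I.length ∈ I.toSet :=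
  ⟨le_rfl, I.left_lt_right⟩

theorem not_disjoint_of_le {I J : DyadicInterval} (h : I ≤ J) : ¬ Disjoint I.toSet J.toSet :=
  Set.not_disjoint_iff.2 ⟨_, I.left_mem, h I.left_mem⟩

theorem abs_sub_center_le {I : DyadicInterval} {x : ℝ} (hx : x ∈ I.toSet) :
    |x - I.center| ≤ I.length / 2 := by
  simp only [toSet, Set.mem_Ico] at hx
  rw [abs_le, center]
  constructor <;> nlinarith [hx.1, hx.2]

theorem center_mem (I : DyadicInterval) : I.center ∈ I.toSet := by
  have := I.length_pos
  constructor <;> simp only [center] <;> nlinarith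

theorem dilate_one (I : DyadicInterval) :
    I.dilate 1 = Set.Icc ((I.pos : ℝ) * I.length) (((I.pos : ℝ) + 1) * I.length) := by
  rw [dilate, Real.closedBall_eq_Icc, center]
  congr 1 <;> ring

theorem measurableSet_toSet (I : DyadicInterval) : MeasurableSet I.toSet := measurableSet_Ico

theorem volume_toSet (I : DyadicInterval) : volume I.toSet = ENNReal.ofReal I.length := by
  rw [toSet, Real.volume_Ico]
  congr 1; ring

/-- The Japanese-bracket type weight `1 + |x - c(I)| / |I|`. -/
noncomputable def bracket (I : DyadicInterval) (x : ℝ) : ℝ := 1 + |x - I.center| / I.length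

theorem one_le_bracket (I : DyadicInterval) (x : ℝ) : 1 ≤ I.bracket x := by
  have := I.length_pos
  unfold bracket
  have : 0 ≤ |x - I.center| / I.length := by positivity
  linarith

theorem bracket_pos (I : DyadicInterval) (x : ℝ) : 0 < I.bracket x :=
  zero_lt_one.trans_le (I.one_le_bracket x)

theorem continuous_bracket (I : DyadicInterval) : Continuous I.bracket := by
  unfold bracket
  fun_prop

theorem bracket_le_of_le {I J : DyadicInterval} (h : J ≤ I) (x : ℝ) :
    I.bracket x ≤ 2 * J.bracket x := by
  have hJ := J.length_pos
  have hI := I.length_pos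
  have hl := length_le_of_le h
  have hc := abs_sub_center_le (h J.center_mem)
  have h1 : |x - I.center| ≤ |x - J.center| + |J.center - I.center| := abs_sub_le _ _ _
  have h2 : |x - I.center| / I.length ≤ |x - J.center| / J.length + 1 := by
    calc |x - I.center| / I.length
        ≤ (|x - J.center| + I.length) / I.length := by gcongr; linarith
      _ = |x - J.center| / I.length + 1 := by field_simp
      _ ≤ _ := by gcongr
  unfold bracket
  have : 0 ≤ |x - J.center| / J.length := by positivity
  linarith

/-- The triangle inequality in multiplicative form: decay at x relative to both intervals is traded
for decay in the distance between them. -/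
theorem bracket_center_le {I J : DyadicInterval} (hl : J.length ≤ I.length) (x : ℝ) :
    I.bracket J.center ≤ I.bracket x * J.bracket x := by
  have hJ := J.length_pos
  have hI := I.length_pos
  have h1 : |J.center - I.center| ≤ |x - I.center| + |x - J.center| := by
    rw [abs_sub_comm x J.center, add_comm]; exact abs_sub_le _ _ _
  have h2 : |J.center - I.center| / I.length ≤
      |x - I.center| / I.length + |x - J.center| / J.length := by
    calc |J.center - I.center| / I.length
        ≤ (|x - I.center| + |x - J.center|) / I.length := by gcongr
      _ = |x - I.center| / I.length + |x - J.center| / I.length := add_div _ _ _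
      _ ≤ _ := by gcongr
  unfold bracket
  have : 0 ≤ |x - J.center| / J.length := by positivity
  have : 0 ≤ |x - I.center| / I.length := by positivity
  nlinarith

/-- The distance to I is at least |x - c(I)| - |I|/2, so passing from distance to the centre costs a
factor 2 in the base. -/
theorem chi_le (I : DyadicInterval) (x : ℝ) : I.chi x ≤ 2 ^ 10 * (I.bracket x ^ 10)⁻¹ := by
  have hI := I.length_pos
  have h1 : |x - I.center| - I.length / 2 ≤ Metric.infDist x I.toSet := by
    refine (Metric.le_infDist ⟨_, I.center_mem⟩).2 fun y hy => ?_
    have := abs_sub_center_le hy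
    have := abs_sub_le x y I.center
    rw [Real.dist_eq]
    linarith
  have h2 : I.bracket x / 2 ≤ 1 + Metric.infDist x I.toSet / I.length := by
    have : (|x - I.center| - I.length / 2) / I.length ≤ Metric.infDist x I.toSet / I.length := by
      gcongr
    have h4 : I.length / 2 / I.length = 1 / 2 := by field_simp
    rw [sub_div, h4] at this
    unfold bracket
    have h3 : 0 ≤ |x - I.center| / I.length := by positivity
    linarith
  have h0 := I.bracket_pos x
  have : I.chi x = ((1 + Metric.infDist x I.toSet / I.length) ^ 10)⁻¹ := by
    rw [chi, zpow_neg]; rfl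
  rw [this]
  calc ((1 + Metric.infDist x I.toSet / I.length) ^ 10)⁻¹ ≤ ((I.bracket x / 2) ^ 10)⁻¹ := by
        gcongr
    _ = _ := by rw [div_pow, inv_div, div_eq_mul_inv]

end DyadicInterval

/-! ### Kernel sums, bumps and almost orthogonality -/

/-- The total mass of the weight `(1 + |x - y| / L) ^ (-2)` is at most `4 L`. -/
theorem lintegral_decay_le {L : ℝ} (hL : 0 < L) (y : ℝ) :
    ∫⁻ x, ENNReal.ofReal (((1 + |x - y| / L) ^ 2)⁻¹) ≤ ENNReal.ofReal (4 * L) := by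
  -- For t ≥ 0, (1 + t)² ≥ 1 + t², so the Cauchy kernel dominates; its mass π L is at most 4 L.
  have h1 : ∀ x : ℝ, ENNReal.ofReal (((1 + |x - y| / L) ^ 2)⁻¹) ≤
      ENNReal.ofReal ((1 + ((x - y) / L) ^ 2)⁻¹) := by
    intro x
    refine ENNReal.ofReal_le_ofReal ?_
    have : 0 ≤ |x - y| / L := by positivity
    have h2 : ((x - y) / L) ^ 2 = (|x - y| / L) ^ 2 := by rw [div_pow, div_pow, sq_abs]
    rw [h2]
    gcongr
    nlinarith
  refine (lintegral_mono h1).trans ?_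
  have hi : Integrable fun x : ℝ => (1 + ((x - y) / L) ^ 2)⁻¹ := by
    have := (integrable_inv_one_add_sq.comp_div hL.ne').comp_sub_right y
    simpa using this
  rw [← ofReal_integral_eq_lintegral_ofReal hi (Filter.Eventually.of_forall fun x => by positivity)]
  refine ENNReal.ofReal_le_ofReal ?_
  have h3 : ∫ x : ℝ, (1 + ((x - y) / L) ^ 2)⁻¹ = L * Real.pi := by
    rw [integral_sub_right_eq_self (fun x : ℝ => (1 + (x / L) ^ 2)⁻¹) y,
      Measure.integral_comp_div (fun x : ℝ => (1 + x ^ 2)⁻¹) L, integral_univ_inv_one_add_sq,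
      abs_of_pos hL, smul_eq_mul]
  rw [h3]
  nlinarith [Real.pi_le_four]

/-- A Schur-type sum over pairwise disjoint dyadic intervals of length at most `L`. -/
theorem sum_length_mul_decay_le {ι : Type*} (s : Finset ι) (J : ι → DyadicInterval) {L : ℝ}
    (hL : 0 < L) (hJ : ∀ i ∈ s, (J i).length ≤ L)
    (hd : ∀ i ∈ s, ∀ j ∈ s, i ≠ j → Disjoint (J i).toSet (J j).toSet) (y : ℝ) :
    ∑ i ∈ s, (J i).length * ((1 + |(J i).center - y| / L) ^ 2)⁻¹ ≤ 16 * L := by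
  -- Moving from the centre of an interval of length at most L to another of its points changes 1 +
  -- |x - y|/L by a factor at most 2. This costs 4 after squaring; disjointness merges the integrals
  -- into one of mass 4 L, whence 16.
  have key : ∀ i ∈ s, ENNReal.ofReal ((J i).length * ((1 + |(J i).center - y| / L) ^ 2)⁻¹) ≤
      ∫⁻ x in (J i).toSet, 4 * ENNReal.ofReal (((1 + |x - y| / L) ^ 2)⁻¹) := by
    intro i hi
    calc ENNReal.ofReal ((J i).length * ((1 + |(J i).center - y| / L) ^ 2)⁻¹)
        = ∫⁻ x in (J i).toSet, ENNReal.ofReal (((1 + |(J i).center - y| / L) ^ 2)⁻¹) := by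
          rw [setLIntegral_const, (J i).volume_toSet, mul_comm,
            ENNReal.ofReal_mul (by positivity)]
      _ ≤ _ := by
          refine setLIntegral_mono' (J i).measurableSet_toSet fun x hx => ?_
          rw [show (4 : ℝ≥0∞) = ENNReal.ofReal 4 by norm_num,
            ← ENNReal.ofReal_mul (by norm_num)]
          refine ENNReal.ofReal_le_ofReal ?_
          have h1 := DyadicInterval.abs_sub_center_le hx
          have h2 : |x - y| ≤ |x - (J i).center| + |(J i).center - y| := abs_sub_le _ _ _
          have h3 : |x - y| / L ≤ 1 + |(J i).center - y| / L := by
            calc |x - y| / L ≤ (L + |(J i).center - y|) / L := by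
                  gcongr
                  linarith [hJ i hi]
              _ = _ := by field_simp
          have h4 : 0 ≤ |(J i).center - y| / L := by positivity
          have h5 : 0 ≤ |x - y| / L := by positivity
          have h6 : (1 + |x - y| / L) ^ 2 ≤ 4 * (1 + |(J i).center - y| / L) ^ 2 := by
            nlinarith
          rw [inv_le_iff_one_le_mul₀ (by positivity)]
          rw [show 4 * ((1 + |x - y| / L) ^ 2)⁻¹ * (1 + |(J i).center - y| / L) ^ 2 =
            4 * (1 + |(J i).center - y| / L) ^ 2 / (1 + |x - y| / L) ^ 2 by ring]
          rwa [one_le_div (by positivity)]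
  have h1 : ENNReal.ofReal (∑ i ∈ s, (J i).length * ((1 + |(J i).center - y| / L) ^ 2)⁻¹) ≤
      ENNReal.ofReal (16 * L) := by
    rw [ENNReal.ofReal_sum_of_nonneg fun i _ => mul_nonneg (J i).length_pos.le (by positivity)]
    refine (Finset.sum_le_sum key).trans ?_
    rw [← lintegral_biUnion_finset (fun i hi j hj hij => hd i hi j hj hij)
      (fun i _ => (J i).measurableSet_toSet)]
    refine (setLIntegral_le_lintegral _ _).trans ?_
    rw [lintegral_const_mul' _ _ (by norm_num)]
    refine (mul_le_mul_right (lintegral_decay_le hL y) 4).trans ?_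
    rw [show (4 : ℝ≥0∞) = ENNReal.ofReal 4 by norm_num, ← ENNReal.ofReal_mul (by norm_num)]
    exact ENNReal.ofReal_le_ofReal (by linarith)
  exact (ENNReal.ofReal_le_ofReal_iff (by positivity)).1 h1

theorem DyadicInterval.integrable_bracket (I : DyadicInterval) :
    Integrable fun x => (I.bracket x ^ 2)⁻¹ := by
  refine ⟨(Continuous.inv₀ (I.continuous_bracket.pow 2)
    fun x => (pow_pos (I.bracket_pos x) 2).ne').aestronglyMeasurable, ?_⟩
  rw [hasFiniteIntegral_iff_ofReal (Filter.Eventually.of_forall fun x => by positivity)]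
  exact (lintegral_decay_le I.length_pos I.center).trans_lt ENNReal.ofReal_lt_top

theorem enorm_pairing_le (f φ : ℝ → ℂ) : ‖pairing f φ‖ₑ ≤ ∫⁻ x, ‖f x‖ₑ * ‖φ x‖ₑ := by
  refine (enorm_integral_le_lintegral_enorm _).trans_eq ?_
  simp [enorm_mul]

theorem norm_pairing_le {f φ : ℝ → ℂ} {c L y : ℝ} (hc : 0 ≤ c) (hL : 0 < L)
    (h : ∀ᵐ x, ‖f x‖ * ‖φ x‖ ≤ c * ((1 + |x - y| / L) ^ 2)⁻¹) :
    ‖pairing f φ‖ ≤ 4 * c * L := by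
  have h1 : ‖pairing f φ‖ₑ ≤ ENNReal.ofReal (4 * c * L) := by
    calc ‖pairing f φ‖ₑ ≤ ∫⁻ x, ‖f x‖ₑ * ‖φ x‖ₑ := enorm_pairing_le f φ
      _ ≤ ∫⁻ x, ENNReal.ofReal c * ENNReal.ofReal (((1 + |x - y| / L) ^ 2)⁻¹) := by
          refine lintegral_mono_ae ?_
          filter_upwards [h] with x hx
          rw [← ofReal_norm, ← ofReal_norm, ← ENNReal.ofReal_mul (norm_nonneg _),
            ← ENNReal.ofReal_mul hc]
          exact ENNReal.ofReal_le_ofReal hx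
      _ ≤ ENNReal.ofReal c * ENNReal.ofReal (4 * L) := by
          rw [lintegral_const_mul' _ _ ENNReal.ofReal_ne_top]
          exact mul_le_mul_right (lintegral_decay_le hL y) _
      _ = _ := by
          rw [← ENNReal.ofReal_mul hc]; congr 1; ring
  rw [← ofReal_norm] at h1
  exact (ENNReal.ofReal_le_ofReal_iff (by positivity)).1 h1

/-- A continuous function which is `L²`-normalized at the scale of `I` and decays like
`dist ^ (-4)` away from `I`. -/
structure IsBump (D : ℝ) (I : DyadicInterval) (v : ℝ → ℂ) : Prop where
  continuous : Continuous v
  bound : ∀ x, ‖v x‖ ≤ D * (√I.length)⁻¹ * (I.bracket x ^ 4)⁻¹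

namespace IsBump

variable {D : ℝ} {I J : DyadicInterval} {u v : ℝ → ℂ}

theorem nonneg (hv : IsBump D I v) : 0 ≤ D := by
  have h := (norm_nonneg _).trans (hv.bound 0)
  have h1 : 0 < (√I.length)⁻¹ := inv_pos.2 (Real.sqrt_pos.2 I.length_pos)
  have h2 : 0 < (I.bracket 0 ^ 4)⁻¹ := inv_pos.2 (pow_pos (I.bracket_pos 0) 4)
  rw [mul_assoc] at h
  exact nonneg_of_mul_nonneg_left h (mul_pos h1 h2)

theorem integrable (hv : IsBump D I v) : Integrable v := by
  refine (I.integrable_bracket.const_mul (D * (√I.length)⁻¹)).mono'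
    hv.continuous.aestronglyMeasurable (Filter.Eventually.of_forall fun x => ?_)
  refine (hv.bound x).trans ?_
  have := hv.nonneg
  have h1 := I.one_le_bracket x
  have h2 := I.bracket_pos x
  gcongr
  norm_num

theorem memLp (hv : IsBump D I v) : MemLp v 2 := by
  rw [memLp_two_iff_integrable_sq_norm hv.continuous.aestronglyMeasurable]
  refine (I.integrable_bracket.const_mul ((D * (√I.length)⁻¹) ^ 2)).mono'
    (hv.continuous.norm.pow 2).aestronglyMeasurable (Filter.Eventually.of_forall fun x => ?_)
  have hD := hv.nonneg
  have h1 := I.one_le_bracket x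
  have h2 := I.bracket_pos x
  rw [Real.norm_of_nonneg (by positivity)]
  calc ‖v x‖ ^ 2 ≤ (D * (√I.length)⁻¹ * (I.bracket x ^ 4)⁻¹) ^ 2 := by
        gcongr; exact hv.bound x
    _ = (D * (√I.length)⁻¹) ^ 2 * (I.bracket x ^ 8)⁻¹ := by
        rw [mul_pow, inv_pow, ← pow_mul]
    _ ≤ _ := by gcongr; norm_num

/-- Two powers of each decay pay for the separation of the intervals through `bracket_center_le`;
the two left on the shorter interval J are integrated, with mass 4|J|. -/
theorem norm_pairing_le (hu : IsBump D I u) (hv : IsBump D J v) (hl : J.length ≤ I.length) :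
    ‖pairing u v‖ ≤ 4 * D ^ 2 * (√J.length / √I.length) * (I.bracket J.center ^ 2)⁻¹ := by
  have hD := hu.nonneg
  have hI := Real.sqrt_pos.2 I.length_pos
  have hJ := Real.sqrt_pos.2 J.length_pos
  have hb := I.bracket_pos J.center
  have := BilinearRdF.norm_pairing_le (f := u) (φ := v) (L := J.length) (y := J.center)
    (c := D ^ 2 * ((√I.length)⁻¹ * (√J.length)⁻¹) * (I.bracket J.center ^ 2)⁻¹) (by positivity)
    J.length_pos (Filter.Eventually.of_forall fun x => ?_)
  · refine this.trans_eq ?_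
    rw [show 4 * (D ^ 2 * ((√I.length)⁻¹ * (√J.length)⁻¹) * (I.bracket J.center ^ 2)⁻¹) *
      J.length = 4 * D ^ 2 * (J.length / √J.length / √I.length) *
      (I.bracket J.center ^ 2)⁻¹ by ring, Real.div_sqrt]
  · have h1 := I.bracket_pos x
    have h2 := J.bracket_pos x
    have h1' := I.one_le_bracket x
    have h2' := J.one_le_bracket x
    change _ ≤ _ * (J.bracket x ^ 2)⁻¹
    calc ‖u x‖ * ‖v x‖ ≤ (D * (√I.length)⁻¹ * (I.bracket x ^ 4)⁻¹) *
          (D * (√J.length)⁻¹ * (J.bracket x ^ 4)⁻¹) := by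
          gcongr
          · exact hu.bound x
          · exact hv.bound x
      _ = D ^ 2 * ((√I.length)⁻¹ * (√J.length)⁻¹) *
          ((I.bracket x ^ 4)⁻¹ * (J.bracket x ^ 4)⁻¹) := by ring
      _ ≤ D ^ 2 * ((√I.length)⁻¹ * (√J.length)⁻¹) *
          ((I.bracket J.center ^ 2)⁻¹ * (J.bracket x ^ 2)⁻¹) := by
          gcongr ?_ * ?_
          rw [← mul_inv, ← mul_inv]
          refine inv_anti₀ (by positivity) ?_
          have h3 : I.bracket J.center ^ 2 ≤ (I.bracket x * J.bracket x) ^ 2 := by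
            gcongr
            exact DyadicInterval.bracket_center_le hl x
          have h4 : I.bracket x ^ 2 ≤ I.bracket x ^ 4 := by gcongr; norm_num
          calc I.bracket J.center ^ 2 * J.bracket x ^ 2
              ≤ (I.bracket x * J.bracket x) ^ 2 * J.bracket x ^ 2 := by gcongr
            _ = I.bracket x ^ 2 * J.bracket x ^ 4 := by ring
            _ ≤ _ := by gcongr
      _ = _ := by ring

end IsBump

/-- An abstract Bessel inequality for almost orthogonal vectors, by the `TT*` method. -/
theorem sum_norm_inner_sq_le {E ι : Type*} [NormedAddCommGroup E] [InnerProductSpace ℂ E]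
    (s : Finset ι) (v : ι → E) (f : E) (n : ι → ι → ℝ) {D : ℝ} (hD : 0 ≤ D)
    (h : ∀ i ∈ s, ∀ j ∈ s, ‖inner ℂ (v i) f‖ * ‖inner ℂ (v j) f‖ * ‖inner ℂ (v i) (v j)‖ ≤
      ‖inner ℂ (v i) f‖ ^ 2 * n i j + ‖inner ℂ (v j) f‖ ^ 2 * n j i)
    (hn : ∀ i ∈ s, ∑ j ∈ s, n i j ≤ D) :
    ∑ i ∈ s, ‖inner ℂ (v i) f‖ ^ 2 ≤ 2 * D * ‖f‖ ^ 2 := by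
  set X := ∑ i ∈ s, ‖inner ℂ (v i) f‖ ^ 2 with hX
  set u := ∑ i ∈ s, inner ℂ (v i) f • v i with hu
  have hX0 : 0 ≤ X := Finset.sum_nonneg fun i _ => by positivity
  have h1 : inner ℂ u f = (X : ℂ) := by
    rw [hu, sum_inner, hX]
    push_cast
    refine Finset.sum_congr rfl fun i _ => ?_
    rw [inner_smul_left, Complex.conj_mul']
  have h2 : X ≤ ‖u‖ * ‖f‖ := by
    have := norm_inner_le_norm (𝕜 := ℂ) u f
    rwa [h1, Complex.norm_real, Real.norm_of_nonneg hX0] at this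
  -- After expansion of ‖u‖², the two halves of the bound on a cross term agree up to relabelling,
  -- and each is a sum of rows of n weighted by the squared coefficients.
  have h3 : ‖u‖ ^ 2 ≤ 2 * D * X := by
    have e : (‖u‖ ^ 2 : ℝ) = ‖(inner ℂ u u : ℂ)‖ := by
      rw [inner_self_eq_norm_sq_to_K]; simp
    rw [e]
    nth_rewrite 1 [hu]
    rw [sum_inner]
    have : ∀ i ∈ s, ‖inner ℂ (inner ℂ (v i) f • v i) u‖ ≤ ∑ j ∈ s,
        (‖inner ℂ (v i) f‖ ^ 2 * n i j + ‖inner ℂ (v j) f‖ ^ 2 * n j i) := by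
      intro i hi
      rw [hu, inner_sum]
      refine (norm_sum_le _ _).trans (Finset.sum_le_sum fun j hj => ?_)
      rw [inner_smul_left, inner_smul_right, norm_mul, norm_mul, RCLike.norm_conj, ← mul_assoc]
      exact h i hi j hj
    refine (norm_sum_le _ _).trans ((Finset.sum_le_sum this).trans ?_)
    simp only [Finset.sum_add_distrib]
    have h4 : ∑ i ∈ s, ∑ j ∈ s, ‖inner ℂ (v i) f‖ ^ 2 * n i j ≤ D * X := by
      rw [hX, Finset.mul_sum]
      refine Finset.sum_le_sum fun i hi => ?_
      rw [← Finset.mul_sum, mul_comm D]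
      exact mul_le_mul_of_nonneg_left (hn i hi) (by positivity)
    rw [Finset.sum_comm (f := fun i j => ‖inner ℂ (v j) f‖ ^ 2 * n j i)]
    linarith
  rcases hX0.eq_or_lt with h0 | h0
  · rw [← h0]; positivity
  · have h5 : X * X ≤ 2 * D * ‖f‖ ^ 2 * X := by
      calc X * X ≤ (‖u‖ * ‖f‖) * (‖u‖ * ‖f‖) := mul_self_le_mul_self hX0 h2
        _ = ‖u‖ ^ 2 * ‖f‖ ^ 2 := by ring
        _ ≤ 2 * D * X * ‖f‖ ^ 2 := by gcongr
        _ = _ := by ring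
    exact le_of_mul_le_mul_right h5 h0

theorem inner_toLp_eq_pairing {f v : ℝ → ℂ} (hv : MemLp v 2) (hf : MemLp f 2) :
    inner ℂ (hv.toLp v) (hf.toLp f) = pairing f v := by
  rw [L2.inner_def, pairing]
  refine integral_congr_ae ?_
  filter_upwards [hv.coeFn_toLp, hf.coeFn_toLp] with x h1 h2
  rw [h1, h2, RCLike.inner_apply]

theorem norm_toLp_sq {f : ℝ → ℂ} (hf : MemLp f 2) :
    ‖hf.toLp f‖ ^ 2 = ∫ x, ‖f x‖ ^ 2 := by
  have h := inner_self_eq_norm_sq_to_K (𝕜 := ℂ) (hf.toLp f)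
  rw [inner_toLp_eq_pairing hf hf, pairing] at h
  have h2 : ∀ x, f x * starRingEnd ℂ (f x) = ((‖f x‖ ^ 2 : ℝ) : ℂ) := fun x => by
    rw [Complex.mul_conj']; simp
  simp only [h2] at h
  rw [integral_complex_ofReal] at h
  exact (Complex.ofReal_injective (h.trans (by norm_cast))).symm

/-- Bessel's inequality for a finite family of bumps whose interactions are spatially separated. -/
theorem sum_norm_pairing_sq_le {ι : Type*} (s : Finset ι) (I : ι → DyadicInterval)
    (v : ι → ℝ → ℂ) {D : ℝ} (hv : ∀ i ∈ s, IsBump D (I i) (v i)) {f : ℝ → ℂ} (hf : MemLp f 2)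
    (hd : ∀ i ∈ s, ∀ j ∈ s, ∀ k ∈ s, (I j).length ≤ (I i).length → (I k).length ≤ (I i).length →
      pairing (v j) (v i) ≠ 0 → pairing (v k) (v i) ≠ 0 → j ≠ k →
      Disjoint (I j).toSet (I k).toSet)
    (hc : ∀ i ∈ s, ∀ j ∈ s, (I j).length ≤ (I i).length → pairing (v j) (v i) ≠ 0 →
      (I j).length = (I i).length ∨
        ‖pairing f (v j)‖ * √(I i).length ≤ 2 * ‖pairing f (v i)‖ * √(I j).length) :
    ∑ i ∈ s, ‖pairing f (v i)‖ ^ 2 ≤ 256 * D ^ 2 * ∫ x, ‖f x‖ ^ 2 := by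
  classical
  -- Each interaction is charged to the longer interval. The 8 is the 4 of `IsBump.norm_pairing_le`
  -- times the 2 from the comparison of coefficients.
  let n : ι → ι → ℝ := fun i j =>
    if (I j).length ≤ (I i).length ∧ pairing (v j) (v i) ≠ 0 then
      8 * D ^ 2 * ((I j).length / (I i).length) * ((I i).bracket (I j).center ^ 2)⁻¹ else 0
  have hn0 : ∀ i j, 0 ≤ n i j := by
    intro i j
    simp only [n]
    split_ifs
    · have := (I i).length_pos
      have := (I j).length_pos
      have := (I i).bracket_pos (I j).center
      positivity
    · exact le_rfl
  have hn : ∀ i ∈ s, ∑ j ∈ s, n i j ≤ 128 * D ^ 2 := by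
    intro i hi
    simp only [n]
    rw [← Finset.sum_filter]
    have hIi := (I i).length_pos
    have h1 := sum_length_mul_decay_le
      (s.filter fun j => (I j).length ≤ (I i).length ∧ pairing (v j) (v i) ≠ 0) I hIi
      (fun j hj => (Finset.mem_filter.1 hj).2.1)
      (fun j hj k hk hjk => hd i hi j (Finset.mem_filter.1 hj).1 k (Finset.mem_filter.1 hk).1
        (Finset.mem_filter.1 hj).2.1 (Finset.mem_filter.1 hk).2.1 (Finset.mem_filter.1 hj).2.2
        (Finset.mem_filter.1 hk).2.2 hjk) (I i).center
    have h2 : ∀ j, 8 * D ^ 2 * ((I j).length / (I i).length) *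
        ((I i).bracket (I j).center ^ 2)⁻¹ = 8 * D ^ 2 / (I i).length *
        ((I j).length * ((1 + |(I j).center - (I i).center| / (I i).length) ^ 2)⁻¹) := by
      intro j
      rw [DyadicInterval.bracket]; ring
    rw [Finset.sum_congr rfl fun j _ => h2 j, ← Finset.mul_sum]
    calc _ ≤ 8 * D ^ 2 / (I i).length * (16 * (I i).length) := by gcongr
      _ = _ := by field_simp; ring
  have key : ∀ i ∈ s, ∀ j ∈ s, (I j).length ≤ (I i).length →
      ‖pairing f (v i)‖ * ‖pairing f (v j)‖ * ‖pairing (v j) (v i)‖ ≤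
      ‖pairing f (v i)‖ ^ 2 * n i j + ‖pairing f (v j)‖ ^ 2 * n j i := by
    intro i hi j hj hl
    have hIi := (I i).length_pos
    have hIj := (I j).length_pos
    have hsi := Real.sqrt_pos.2 hIi
    have hsj := Real.sqrt_pos.2 hIj
    have hb := (I i).bracket_pos (I j).center
    by_cases h0 : pairing (v j) (v i) = 0
    · rw [h0, norm_zero, mul_zero]
      exact add_nonneg (mul_nonneg (by positivity) (hn0 i j))
        (mul_nonneg (by positivity) (hn0 j i))
    have hsymm : ‖pairing (v j) (v i)‖ = ‖pairing (v i) (v j)‖ := by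
      rw [← RCLike.norm_conj (pairing (v j) (v i)), pairing, ← integral_conj, pairing]
      simp [mul_comm]
    have hp : ‖pairing (v j) (v i)‖ ≤ _ :=
      hsymm.trans_le ((hv i hi).norm_pairing_le (hv j hj) hl)
    have hnij : n i j = 8 * D ^ 2 * ((I j).length / (I i).length) *
        ((I i).bracket (I j).center ^ 2)⁻¹ := if_pos ⟨hl, h0⟩
    -- At equal lengths the product of coefficients is split by the arithmetic-geometric mean
    -- inequality. Otherwise the shorter interval's coefficient is dominated by that of i, and
    -- everything is charged to i.
    rcases hc i hi j hj hl h0 with he | he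
    · have h0' : pairing (v i) (v j) ≠ 0 := by
        rw [← norm_ne_zero_iff, ← hsymm]; exact norm_ne_zero_iff.2 h0
      have hnji : n j i = 8 * D ^ 2 * ((I i).length / (I j).length) *
        ((I j).bracket (I i).center ^ 2)⁻¹ := if_pos ⟨he.ge, h0'⟩
      have hbb : (I j).bracket (I i).center = (I i).bracket (I j).center := by
        rw [DyadicInterval.bracket, DyadicInterval.bracket, he, abs_sub_comm]
      rw [hnij, hnji, hbb, he, div_self hIi.ne']
      rw [he, div_self hsi.ne'] at hp
      have h2 : ‖pairing f (v i)‖ * ‖pairing f (v j)‖ ≤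
          ‖pairing f (v i)‖ ^ 2 + ‖pairing f (v j)‖ ^ 2 := by
        nlinarith [sq_nonneg (‖pairing f (v i)‖ - ‖pairing f (v j)‖),
          sq_nonneg (‖pairing f (v i)‖), sq_nonneg (‖pairing f (v j)‖)]
      calc _ ≤ (‖pairing f (v i)‖ ^ 2 + ‖pairing f (v j)‖ ^ 2) *
            (8 * D ^ 2 * 1 * ((I i).bracket (I j).center ^ 2)⁻¹) := by
            gcongr
            refine hp.trans ?_
            gcongr
            norm_num
        _ = _ := by ring
    · refine le_add_of_le_of_nonneg ?_ (mul_nonneg (by positivity) (hn0 j i))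
      rw [hnij]
      have h2 : ‖pairing f (v j)‖ ≤ 2 * ‖pairing f (v i)‖ * (√(I j).length / √(I i).length) := by
        rw [← mul_div_assoc, le_div_iff₀ hsi]; exact he
      calc _ ≤ ‖pairing f (v i)‖ * (2 * ‖pairing f (v i)‖ * (√(I j).length / √(I i).length)) *
            (4 * D ^ 2 * (√(I j).length / √(I i).length) *
              ((I i).bracket (I j).center ^ 2)⁻¹) := by gcongr
        _ = ‖pairing f (v i)‖ ^ 2 * (8 * D ^ 2 * (√(I j).length / √(I i).length) ^ 2 *
              ((I i).bracket (I j).center ^ 2)⁻¹) := by ring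
        _ = _ := by rw [div_pow, Real.sq_sqrt hIi.le, Real.sq_sqrt hIj.le]
  let V : ι → Lp ℂ 2 (volume : Measure ℝ) := fun i =>
    if h : MemLp (v i) 2 then h.toLp (v i) else 0
  have hV : ∀ i (hi : i ∈ s), V i = ((hv i hi).memLp).toLp (v i) := fun i hi => dif_pos _
  have h1 : ∀ i ∈ s, inner ℂ (V i) (hf.toLp f) = pairing f (v i) := fun i hi => by
    rw [hV i hi, inner_toLp_eq_pairing]
  have h2 : ∀ i ∈ s, ∀ j ∈ s, inner ℂ (V i) (V j) = pairing (v j) (v i) := fun i hi j hj => by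
    rw [hV i hi, hV j hj, inner_toLp_eq_pairing]
  have := sum_norm_inner_sq_le s V (hf.toLp f) n (D := 128 * D ^ 2) (by positivity) ?_ hn
  · rw [norm_toLp_sq] at this
    calc _ = ∑ i ∈ s, ‖inner ℂ (V i) (hf.toLp f)‖ ^ 2 :=
          Finset.sum_congr rfl fun i hi => by rw [h1 i hi]
      _ ≤ _ := this
      _ = _ := by ring
  · intro i hi j hj
    rw [h1 i hi, h1 j hj, h2 i hi j hj]
    rcases le_total (I j).length (I i).length with hl | hl
    · exact key i hi j hj hl
    · have hsymm : ‖pairing (v j) (v i)‖ = ‖pairing (v i) (v j)‖ := by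
        rw [← RCLike.norm_conj (pairing (v j) (v i)), pairing, ← integral_conj, pairing]
        simp [mul_comm]
      have := key j hj i hi hl
      rw [hsymm]
      linarith [mul_comm ‖pairing f (v i)‖ ‖pairing f (v j)‖, this,
        congrArg (· * ‖pairing (v i) (v j)‖) (mul_comm ‖pairing f (v i)‖ ‖pairing f (v j)‖)]

/-! ### Frequency supports, packets and affine weights -/

theorem integrable_fourier_of_support {u : ℝ → ℂ} (hu : Integrable u) {ω : DyadicInterval}
    (h : Function.support (𝓕 u) ⊆ ω.dilate 1) : Integrable (𝓕 u) := by
  have hc : Continuous (𝓕 u) :=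
    VectorFourier.fourierIntegral_continuous Real.continuous_fourierChar continuous_inner hu
  refine hc.integrable_of_hasCompactSupport ?_
  exact HasCompactSupport.of_support_subset_isCompact (isCompact_closedBall _ _) h

/-- Functions with frequency supports in disjoint dyadic intervals are orthogonal. -/
theorem pairing_eq_zero_of_disjoint {u v : ℝ → ℂ} (hu : Continuous u) (hui : Integrable u)
    (hvi : Integrable v) {ω ω' : DyadicInterval}
    (h : Function.support (𝓕 u) ⊆ ω.dilate 1) (h' : Function.support (𝓕 v) ⊆ ω'.dilate 1)
    (hd : Disjoint ω.toSet ω'.toSet) : pairing u v = 0 := by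
  have hFu := integrable_fourier_of_support hui h
  -- Parseval's identity: moving the transform from v onto 𝓕 u produces an inverse transform, which
  -- inversion identifies with u pointwise.
  have key := VectorFourier.integral_sesq_fourierIntegral_eq_neg_flip (innerSL ℂ (E := ℂ))
    (L := innerₗ ℝ) (f := v) (g := 𝓕 u) (μ := volume) (ν := volume)
    Real.continuous_fourierChar continuous_inner hvi hFu
  have key' : ∫ ξ, inner ℂ (𝓕 v ξ) (𝓕 u ξ) = ∫ x, inner ℂ (v x) (𝓕⁻ (𝓕 u) x) := by
    simpa using! key
  rw [hu.fourierInv_fourier_eq hui hFu] at key'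
  have h0 : ∫ ξ, inner ℂ (𝓕 v ξ) (𝓕 u ξ) = 0 := by
    refine integral_eq_zero_of_ae ?_
    -- The supports lie in closed intervals, which may share an endpoint although the half-open ones
    -- are disjoint; endpoints are a null set.
    have e1 := Ico_ae_eq_Icc (μ := (volume : Measure ℝ)) (a := (ω.pos : ℝ) * ω.length)
      (b := ((ω.pos : ℝ) + 1) * ω.length)
    have e2 := Ico_ae_eq_Icc (μ := (volume : Measure ℝ)) (a := (ω'.pos : ℝ) * ω'.length)
      (b := ((ω'.pos : ℝ) + 1) * ω'.length)
    filter_upwards [e1.mem_iff, e2.mem_iff] with ξ h1 h2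
    by_contra hne
    have hv0 : 𝓕 v ξ ≠ 0 := fun h0 => hne (by rw [h0, inner_zero_left]; rfl)
    have hu0 : 𝓕 u ξ ≠ 0 := fun h0 => hne (by rw [h0, inner_zero_right]; rfl)
    have m1 := h hu0
    have m2 := h' hv0
    rw [DyadicInterval.dilate_one] at m1 m2
    exact Set.disjoint_left.1 hd (h1.2 m1) (h2.2 m2)
  rw [pairing, ← h0, key']
  simp [RCLike.inner_apply]

/-- The properties of a wave packet with frequency support in `ω` which the estimates use. -/
structure IsPacket (D : ℝ) (I ω : DyadicInterval) (φ : ℝ → ℂ) : Prop where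
  continuous : Continuous φ
  bound : ∀ x, ‖φ x‖ ≤ D * (√I.length)⁻¹ * (I.bracket x ^ 10)⁻¹
  support : Function.support (𝓕 φ) ⊆ ω.dilate 1

/-- The affine weight `1 + i (x - c(P)) / |P|`. -/
noncomputable def affineWeight (P : DyadicInterval) (x : ℝ) : ℂ :=
  1 + ((x - P.center) / P.length : ℝ) * Complex.I

theorem normSq_affineWeight (P : DyadicInterval) (x : ℝ) :
    ‖affineWeight P x‖ ^ 2 = 1 + ((x - P.center) / P.length) ^ 2 := by
  rw [← Complex.normSq_eq_norm_sq, Complex.normSq_apply]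
  simp [affineWeight]
  ring

theorem norm_affineWeight_le (P : DyadicInterval) (x : ℝ) : ‖affineWeight P x‖ ≤ P.bracket x := by
  have hP := P.length_pos
  refine abs_le_of_sq_le_sq' ?_ (P.bracket_pos x).le |>.2
  rw [normSq_affineWeight, DyadicInterval.bracket, ← sq_abs ((x - P.center) / P.length), abs_div,
    abs_of_pos hP]
  have : 0 ≤ |x - P.center| / P.length := by positivity
  nlinarith

theorem affineWeight_ne_zero (P : DyadicInterval) (x : ℝ) : affineWeight P x ≠ 0 := by
  intro h
  have := normSq_affineWeight P x
  rw [h, norm_zero] at this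
  nlinarith [sq_nonneg ((x - P.center) / P.length)]

theorem inv_normSq_affineWeight_le (P : DyadicInterval) (x : ℝ) :
    (‖affineWeight P x‖ ^ 2)⁻¹ ≤ 2 * (P.bracket x ^ 2)⁻¹ := by
  have hP := P.length_pos
  rw [normSq_affineWeight, DyadicInterval.bracket, ← sq_abs ((x - P.center) / P.length), abs_div,
    abs_of_pos hP]
  have : 0 ≤ |x - P.center| / P.length := by positivity
  rw [← div_eq_mul_inv, inv_le_comm₀ (by positivity) (by positivity), inv_div,
    div_le_iff₀ (by norm_num)]
  nlinarith [sq_nonneg (|x - P.center| / P.length - 1)]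

theorem continuous_affineWeight (P : DyadicInterval) : Continuous (affineWeight P) := by
  unfold affineWeight
  fun_prop

namespace IsPacket

variable {D : ℝ} {I ω P : DyadicInterval} {φ : ℝ → ℂ}

theorem nonneg (h : IsPacket D I ω φ) : 0 ≤ D := by
  have h := (norm_nonneg _).trans (h.bound 0)
  have h1 : 0 < (√I.length)⁻¹ := inv_pos.2 (Real.sqrt_pos.2 I.length_pos)
  have h2 : 0 < (I.bracket 0 ^ 10)⁻¹ := inv_pos.2 (pow_pos (I.bracket_pos 0) 10)
  rw [mul_assoc] at h
  exact nonneg_of_mul_nonneg_left h (mul_pos h1 h2)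

theorem isBump (h : IsPacket D I ω φ) : IsBump D I φ where
  continuous := h.continuous
  bound x := by
    refine (h.bound x).trans ?_
    have := h.nonneg
    have h1 := I.one_le_bracket x
    gcongr
    norm_num

/-- The weight grows linearly on the scale of P ⊇ I, hence costs one of the ten powers of decay and
a factor 2. -/
theorem isBump_affineWeight_mul (h : IsPacket D I ω φ) (hP : I ≤ P) :
    IsBump (2 * D) I (fun x => affineWeight P x * φ x) where
  continuous := (continuous_affineWeight P).mul h.continuous
  bound x := by
    have hD := h.nonneg
    have h1 := I.one_le_bracket x
    have h0 := I.bracket_pos x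
    rw [norm_mul]
    calc ‖affineWeight P x‖ * ‖φ x‖
        ≤ (2 * I.bracket x) * (D * (√I.length)⁻¹ * (I.bracket x ^ 10)⁻¹) := by
          gcongr
          · exact (norm_affineWeight_le P x).trans (DyadicInterval.bracket_le_of_le hP x)
          · exact h.bound x
      _ = 2 * D * (√I.length)⁻¹ * (I.bracket x ^ 9)⁻¹ := by field_simp
      _ ≤ _ := by gcongr; norm_num

/-- The function x is a linear combination of 1 and the affine weight of I. This integrability
allows 𝓕 φ to be differentiated. -/
theorem integrable_mul (h : IsPacket D I ω φ) : Integrable fun x : ℝ => x • φ x := by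
  have h1 := (h.isBump_affineWeight_mul (le_refl I)).integrable
  have h2 := h.isBump.integrable
  have hI := I.length_pos
  have h3 : (fun x : ℝ => x • φ x) = fun x => (-Complex.I * I.length) * (affineWeight I x * φ x) +
      (I.center + Complex.I * I.length) * φ x := by
    funext x
    have hL : (I.length : ℂ) ≠ 0 := by exact_mod_cast hI.ne'
    simp only [affineWeight, Complex.real_smul]
    push_cast
    field_simp
    ring_nf
    simp only [Complex.I_sq]
    ring
  rw [h3]
  exact (h1.const_mul _).add (h2.const_mul _)

/-- On the frequency side an affine weight is a first-order differential operator. The dilate is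
closed, so 𝓕 φ vanishes near every point outside it, and so does its derivative. This is the reason
for a complex affine weight: it localizes in space without spreading frequencies. -/
theorem support_fourier_affineWeight_mul (h : IsPacket D I ω φ) :
    Function.support (𝓕 (fun x => affineWeight P x * φ x)) ⊆ ω.dilate 1 := by
  intro ξ hξ
  by_contra hn
  refine hξ ?_
  have hi := h.isBump.integrable
  have hx := h.integrable_mul
  have hL : (P.length : ℂ) ≠ 0 := by exact_mod_cast P.length_pos.ne'
  have hpi : (Real.pi : ℂ) ≠ 0 := by exact_mod_cast Real.pi_ne_zero
  have hev : 𝓕 φ =ᶠ[nhds ξ] fun _ => 0 := by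
    filter_upwards [Metric.isClosed_closedBall.isOpen_compl.mem_nhds hn] with η hη
    by_contra h0
    exact hη (h.support h0)
  have h0 : 𝓕 φ ξ = 0 := hev.self_of_nhds
  have h1 : 𝓕 (fun x : ℝ => (-2 * Real.pi * Complex.I * x) • φ x) ξ = 0 :=
    (Real.hasDerivAt_fourier hi hx ξ).unique ((hasDerivAt_const ξ (0 : ℂ)).congr_of_eventuallyEq hev)
  have hi2 : Integrable fun x : ℝ => (-2 * Real.pi * Complex.I * x) • φ x := by
    have := hx.const_mul (-2 * Real.pi * Complex.I)
    refine this.congr (Filter.Eventually.of_forall fun x => ?_)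
    simp only [Complex.real_smul, smul_eq_mul]
    ring
  have h3 : (fun x => affineWeight P x * φ x) = fun x : ℝ =>
      (1 - P.center / P.length * Complex.I) • φ x +
      (-(1 / (2 * Real.pi * P.length)) : ℂ) • ((-2 * Real.pi * Complex.I * x) • φ x) := by
    funext x
    simp only [affineWeight, smul_eq_mul]
    push_cast
    field_simp
    ring
  rw [h3, Real.fourier_eq]
  rw [Real.fourier_eq] at h0 h1
  have c1 := (Real.fourierIntegral_convergent_iff ξ).2 hi
  have c2 := (Real.fourierIntegral_convergent_iff ξ).2 hi2
  simp only [smul_add, smul_comm _ (1 - (P.center : ℂ) / P.length * Complex.I),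
    smul_comm _ (-(1 / (2 * Real.pi * P.length)) : ℂ)]
  refine (integral_add (c1.smul (1 - (P.center : ℂ) / P.length * Complex.I))
    (c2.smul (-(1 / (2 * Real.pi * P.length)) : ℂ))).trans ?_
  simp only [Pi.smul_apply, integral_smul, h0, h1, smul_zero, add_zero]

end IsPacket

/-! ### Localized Bessel inequality and energy inequality -/

/-- The localized Bessel inequality for the packets in a column over the interval `P`. -/
theorem sum_norm_pairing_sq_le_of_column {ι : Type*} (s : Finset ι) (I ω : ι → DyadicInterval)
    (φ : ι → ℝ → ℂ) (P : DyadicInterval) {D : ℝ} (hφ : ∀ i ∈ s, IsPacket D (I i) (ω i) (φ i))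
    (hP : ∀ i ∈ s, I i ≤ P)
    (hd : ∀ i ∈ s, ∀ j ∈ s, i ≠ j → Disjoint (ω i).toSet (ω j).toSet ∨
      ω i = ω j ∧ (I i).length = (I j).length ∧ Disjoint (I i).toSet (I j).toSet)
    {g : ℝ → ℂ} (hg : MemLp g 2) :
    ∑ i ∈ s, ‖pairing g (φ i)‖ ^ 2 ≤ 2048 * D ^ 2 * ∫ x, ‖g x‖ ^ 2 * (P.bracket x ^ 2)⁻¹ := by
  let v : ι → ℝ → ℂ := fun i x => affineWeight P x * φ i x
  -- Dividing g by the conjugate weight and multiplying the packets by the weight leaves every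
  -- coefficient unchanged and moves the localization onto g.
  let g' : ℝ → ℂ := fun x => (starRingEnd ℂ (affineWeight P x))⁻¹ * g x
  have hv : ∀ i ∈ s, IsBump (2 * D) (I i) (v i) :=
    fun i hi => (hφ i hi).isBump_affineWeight_mul (hP i hi)
  have hw1 : ∀ x, (‖affineWeight P x‖ ^ 2)⁻¹ ≤ 1 := fun x => by
    rw [normSq_affineWeight]
    exact inv_le_one_of_one_le₀ (by nlinarith [sq_nonneg ((x - P.center) / P.length)])
  have hcont : Continuous fun x => (starRingEnd ℂ (affineWeight P x))⁻¹ :=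
    Continuous.inv₀ (Complex.continuous_conj.comp (continuous_affineWeight P))
      fun x => (map_ne_zero _).2 (affineWeight_ne_zero P x)
  have hng' : ∀ x, ‖g' x‖ ^ 2 = (‖affineWeight P x‖ ^ 2)⁻¹ * ‖g x‖ ^ 2 := fun x => by
    simp only [g']
    rw [norm_mul, norm_inv, RCLike.norm_conj, mul_pow, inv_pow]
  have hg' : MemLp g' 2 := by
    refine hg.of_le (hcont.aestronglyMeasurable.mul hg.1) (Filter.Eventually.of_forall fun x => ?_)
    refine abs_le_of_sq_le_sq' ?_ (norm_nonneg _) |>.2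
    rw [hng']
    exact mul_le_of_le_one_left (by positivity) (hw1 x)
  have hpair : ∀ i, pairing g (φ i) = pairing g' (v i) := fun i => by
    simp only [pairing, g', v]
    refine integral_congr_ae (Filter.Eventually.of_forall fun x => ?_)
    have : starRingEnd ℂ (affineWeight P x) ≠ 0 := (map_ne_zero _).2 (affineWeight_ne_zero P x)
    simp only [map_mul]
    field_simp
  have hor : ∀ i ∈ s, ∀ j ∈ s, pairing (v j) (v i) ≠ 0 → ¬ Disjoint (ω j).toSet (ω i).toSet :=
    fun i hi j hj h0 hdis => h0 (pairing_eq_zero_of_disjoint (hv j hj).continuous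
      (hv j hj).integrable (hv i hi).integrable (hφ j hj).support_fourier_affineWeight_mul
      (hφ i hi).support_fourier_affineWeight_mul hdis)
  have hsame : ∀ i ∈ s, ∀ j ∈ s, pairing (v j) (v i) ≠ 0 →
      ω j = ω i ∧ (I j).length = (I i).length := by
    intro i hi j hj h0
    by_cases hij : j = i
    · rw [hij]; exact ⟨rfl, rfl⟩
    · rcases hd j hj i hi hij with h | h
      · exact absurd h (hor i hi j hj h0)
      · exact ⟨h.1, h.2.1⟩
  have := sum_norm_pairing_sq_le s I v hv hg' ?_ ?_
  · simp only [hpair]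
    refine this.trans ?_
    -- The weighted packets have constant 2D, and the inverse square of the weight is at most twice
    -- that of the bracket: 256 · 4 · 2 = 2048.
    rw [show 2048 * D ^ 2 = 256 * (2 * D) ^ 2 * 2 by ring, mul_assoc (256 * (2 * D) ^ 2) 2]
    refine mul_le_mul_of_nonneg_left ?_ (by positivity)
    have hgi : Integrable fun x => ‖g x‖ ^ 2 := hg.integrable_norm_pow (by norm_num)
    rw [← integral_const_mul]
    refine integral_mono (hg'.integrable_norm_pow (by norm_num)) ?_ fun x => ?_
    · refine (hgi.mono' ?_ (Filter.Eventually.of_forall fun x => ?_)).const_mul 2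
      · exact (hg.1.norm.pow 2).mul (Continuous.inv₀ (P.continuous_bracket.pow 2)
          fun x => (pow_pos (P.bracket_pos x) 2).ne').aestronglyMeasurable
      · have h1 := P.one_le_bracket x
        rw [Real.norm_of_nonneg (by positivity)]
        exact mul_le_of_le_one_right (by positivity) (inv_le_one_of_one_le₀ (one_le_pow₀ h1))
    · change ‖g' x‖ ^ 2 ≤ 2 * (‖g x‖ ^ 2 * (P.bracket x ^ 2)⁻¹)
      rw [hng']
      calc _ ≤ 2 * (P.bracket x ^ 2)⁻¹ * ‖g x‖ ^ 2 := by
            gcongr; exact inv_normSq_affineWeight_le P x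
        _ = _ := by ring
  · intro i hi j hj k hk _ _ h1 h2 hjk
    have e1 := hsame i hi j hj h1
    have e2 := hsame i hi k hk h2
    rcases hd j hj k hk hjk with h | h
    · rw [e1.1, e2.1] at h
      exact absurd h (DyadicInterval.not_disjoint_of_le le_rfl)
    · exact h.2.2
  · intro i hi j hj _ h1
    exact Or.inl (hsame i hi j hj h1).2

/-- The energy inequality: the tops of pairwise disjoint tiles with comparable coefficients. -/
theorem sum_length_le_of_disjoint_tiles {ι : Type*} (s : Finset ι) (I ω : ι → DyadicInterval)
    (φ : ι → ℝ → ℂ) {D κ : ℝ} (hκ : 0 ≤ κ) (hφ : ∀ i ∈ s, IsPacket D (I i) (ω i) (φ i))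
    (harea : ∀ i ∈ s, (I i).length * (ω i).length = 1)
    (hd : ∀ i ∈ s, ∀ j ∈ s, i ≠ j → Disjoint (I i).toSet (I j).toSet ∨
      Disjoint (ω i).toSet (ω j).toSet)
    {f : ℝ → ℂ} (hf : MemLp f 2)
    (hlow : ∀ i ∈ s, κ * √(I i).length ≤ ‖pairing f (φ i)‖)
    (hup : ∀ i ∈ s, ‖pairing f (φ i)‖ ≤ 2 * κ * √(I i).length) :
    κ ^ 2 * ∑ i ∈ s, (I i).length ≤ 256 * D ^ 2 * ∫ x, ‖f x‖ ^ 2 := by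
  -- Interacting packets have nested frequency intervals, the one over the longer spatial interval
  -- being the smaller. Two packets interacting with the same i over intervals no longer than I_i
  -- thus have overlapping frequencies, so disjointness of their tiles must be spatial.
  have hor : ∀ i ∈ s, ∀ j ∈ s, (I j).length ≤ (I i).length → pairing (φ j) (φ i) ≠ 0 →
      ω i ≤ ω j := by
    intro i hi j hj hl h0
    have hIi := (I i).length_pos
    have hIj := (I j).length_pos
    refine DyadicInterval.le_of_not_disjoint ?_ fun hdis => h0 (pairing_eq_zero_of_disjoint
      (hφ j hj).continuous (hφ j hj).isBump.integrable (hφ i hi).isBump.integrable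
      (hφ j hj).support (hφ i hi).support hdis.symm)
    rw [eq_inv_of_mul_eq_one_right (harea i hi), eq_inv_of_mul_eq_one_right (harea j hj)]
    exact inv_anti₀ hIj hl
  refine le_trans ?_ (sum_norm_pairing_sq_le s I φ (fun i hi => (hφ i hi).isBump) hf ?_ ?_)
  · rw [Finset.mul_sum]
    refine Finset.sum_le_sum fun i hi => ?_
    calc κ ^ 2 * (I i).length = (κ * √(I i).length) ^ 2 := by
          rw [mul_pow, Real.sq_sqrt (I i).length_pos.le]
      _ ≤ _ := by
          have := hlow i hi
          gcongr
  · intro i hi j hj k hk hl1 hl2 h1 h2 hjk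
    have e1 := hor i hi j hj hl1 h1
    have e2 := hor i hi k hk hl2 h2
    rcases hd j hj k hk hjk with h | h
    · exact h
    · exact absurd (Set.disjoint_of_subset e1 e2 h) (DyadicInterval.not_disjoint_of_le le_rfl)
  · intro i hi j hj _ _
    right
    calc _ ≤ (2 * κ * √(I j).length) * √(I i).length := by gcongr; exact hup j hj
      _ = 2 * (κ * √(I i).length) * √(I j).length := by ring
      _ ≤ _ := by gcongr; exact hlow i hi

/-! ### The exceptional set and weighted density bounds -/

/-- The union of the balls on which the density of `F` exceeds `25 |F|`. -/
def exceptionalSet (F : Set ℝ) : Set ℝ :=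
  ⋃ p ∈ {p : ℝ × ℝ | 50 * volume.real F * p.2 < volume.real (F ∩ Metric.ball p.1 p.2)},
    Metric.ball p.1 p.2

theorem isOpen_exceptionalSet (F : Set ℝ) : IsOpen (exceptionalSet F) :=
  isOpen_biUnion fun _ _ => Metric.isOpen_ball

theorem measureReal_inter_ball_le {F : Set ℝ} {x : ℝ} (hx : x ∉ exceptionalSet F) {ρ : ℝ}
    (hρ : 0 < ρ) : volume.real (F ∩ Metric.ball x ρ) ≤ 50 * volume.real F * ρ := by
  by_contra! h
  exact hx (Set.mem_biUnion (x := (x, ρ)) h (Metric.mem_ball_self hρ))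

/-- The weak type bound for the exceptional set, from the Vitali covering lemma. -/
theorem volume_exceptionalSet_le {F : Set ℝ} (hF : MeasurableSet F) (hFfin : volume F < ∞) :
    volume (exceptionalSet F) ≤ ENNReal.ofReal (1 / 5) := by
  set t : Set (ℝ × ℝ) :=
    {p | 0 < p.2 ∧ 50 * volume.real F * p.2 < volume.real (F ∩ Metric.ball p.1 p.2)} with ht
  have hEt : exceptionalSet F ⊆ ⋃ p ∈ t, Metric.closedBall p.1 p.2 := by
    refine Set.iUnion₂_subset fun p hp => ?_
    rcases le_or_gt p.2 0 with h | h
    · rw [Metric.ball_eq_empty.2 h]; exact Set.empty_subset _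
    · exact Metric.ball_subset_closedBall.trans
        (Set.subset_biUnion_of_mem (u := fun p : ℝ × ℝ => Metric.closedBall p.1 p.2)
          (show p ∈ t from ⟨h, hp⟩))
  have hle : ∀ p : ℝ × ℝ, volume.real (F ∩ Metric.ball p.1 p.2) ≤ volume.real F :=
    fun p => measureReal_mono Set.inter_subset_left hFfin.ne
  rcases (measureReal_nonneg (μ := volume) (s := F)).eq_or_lt with h0 | h0
  · have : t = ∅ := by
      refine Set.eq_empty_of_forall_notMem fun p hp => ?_
      have h1 := hp.2
      have h2 := hle p
      rw [← h0] at h1 h2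
      linarith
    rw [this] at hEt
    simp only [Set.mem_empty_iff_false, Set.iUnion_of_empty, Set.iUnion_empty] at hEt
    rw [Set.subset_empty_iff.1 hEt]
    simp
  -- Vitali's lemma needs bounded radii; a ball cannot contain more of F than |F|, so 50 ρ < 1.
  have hR : ∀ p ∈ t, p.2 ≤ 1 / 50 := by
    intro p hp
    have h1 := hp.2.trans_le (hle p)
    by_contra! h2
    nlinarith
  obtain ⟨u, hut, hdis, hcov⟩ := Vitali.exists_disjoint_subfamily_covering_enlargement_closedBall
    t Prod.fst Prod.snd (1 / 50) hR 5 (by norm_num)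
  have hcount : u.Countable := by
    refine hdis.countable_of_nonempty_interior fun p hp => ?_
    rw [interior_closedBall _ (hut hp).1.ne']
    exact Metric.nonempty_ball.2 (hut hp).1
  have h1 : exceptionalSet F ⊆ ⋃ p ∈ u, Metric.closedBall p.1 (5 * p.2) := by
    refine hEt.trans (Set.iUnion₂_subset fun p hp => ?_)
    obtain ⟨q, hq, hpq⟩ := hcov p hp
    exact hpq.trans
      (Set.subset_biUnion_of_mem (u := fun p : ℝ × ℝ => Metric.closedBall p.1 (5 * p.2)) hq)
  -- A fivefold enlarged ball has length 10ρ, while 50 |F| ρ < |F ∩ B|; this gives the 1/5.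
  -- Disjointness bounds the sum of the |F ∩ B| by |F|, which is cancelled at the end.
  have h2 : volume (exceptionalSet F) * volume F ≤ ENNReal.ofReal (1 / 5) * volume F := by
    calc volume (exceptionalSet F) * volume F
        ≤ (∑' p : u, volume (Metric.closedBall (p : ℝ × ℝ).1 (5 * (p : ℝ × ℝ).2))) * volume F := by
          gcongr
          exact (measure_mono h1).trans (measure_biUnion_le _ hcount _)
      _ = ∑' p : u, volume (Metric.closedBall (p : ℝ × ℝ).1 (5 * (p : ℝ × ℝ).2)) * volume F :=
          ENNReal.tsum_mul_right.symm
      _ ≤ ∑' p : u, ENNReal.ofReal (1 / 5) *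
            volume (F ∩ Metric.closedBall (p : ℝ × ℝ).1 (p : ℝ × ℝ).2) := by
          refine ENNReal.tsum_le_tsum fun p => ?_
          have hp := hut p.2
          rw [Real.volume_closedBall, ← ENNReal.ofReal_toReal hFfin.ne,
            ← ENNReal.ofReal_mul (by linarith [hp.1])]
          refine le_trans ?_ (mul_le_mul_right
            (measure_mono (Set.inter_subset_inter_right F Metric.ball_subset_closedBall)) _)
          rw [← ENNReal.ofReal_toReal ((measure_mono (Set.inter_subset_left
            (t := Metric.ball (p : ℝ × ℝ).1 (p : ℝ × ℝ).2))).trans_lt hFfin).ne,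
            ← ENNReal.ofReal_mul (by norm_num)]
          refine ENNReal.ofReal_le_ofReal ?_
          have := hp.2
          simp only [Measure.real] at this
          linarith
      _ = ENNReal.ofReal (1 / 5) *
            volume (⋃ p ∈ u, F ∩ Metric.closedBall (p : ℝ × ℝ).1 (p : ℝ × ℝ).2) := by
          rw [ENNReal.tsum_mul_left, measure_biUnion hcount ?_ ?_]
          · intro p hp q hq hpq
            exact (hdis hp hq hpq).mono Set.inter_subset_right Set.inter_subset_right
          · exact fun p _ => hF.inter Metric.isClosed_closedBall.measurableSet
      _ ≤ _ := by
          gcongr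
          exact Set.iUnion₂_subset fun p _ => Set.inter_subset_left
  have hF0 : volume F ≠ 0 := by
    intro h
    rw [Measure.real, h] at h0
    simp at h0
  exact (ENNReal.mul_le_mul_iff_left hF0 hFfin.ne).1 h2

/-- Only the least j whose ball contains x is needed: for j > 0 minimality gives |x - c(I)| ≥
2^(j-1)|I|, and the factor 4 absorbs the shift of index. -/
theorem ofReal_inv_bracket_sq_le (I : DyadicInterval) (x : ℝ) :
    ENNReal.ofReal ((I.bracket x ^ 2)⁻¹) ≤ ∑' j : ℕ, ENNReal.ofReal (4 * (4 ^ j)⁻¹) *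
      (Metric.ball I.center (2 ^ j * I.length)).indicator 1 x := by
  classical
  have hI := I.length_pos
  have hex : ∃ j : ℕ, |x - I.center| / I.length < 2 ^ j :=
    pow_unbounded_of_one_lt _ one_lt_two
  have hj := Nat.find_spec hex
  refine le_trans ?_ (ENNReal.le_tsum (Nat.find hex))
  rw [Set.indicator_of_mem (by rwa [Metric.mem_ball, Real.dist_eq, ← div_lt_iff₀ hI]),
    Pi.one_apply, mul_one]
  refine ENNReal.ofReal_le_ofReal ?_
  have h0 : 0 ≤ |x - I.center| / I.length := by positivity
  unfold DyadicInterval.bracket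
  rcases hk : Nat.find hex with _ | k
  · rw [pow_zero, inv_one, mul_one]
    refine (inv_le_one_of_one_le₀ (one_le_pow₀ (by linarith))).trans (by norm_num)
  · have h1 : (2 : ℝ) ^ k ≤ |x - I.center| / I.length :=
      not_lt.1 (Nat.find_min hex (by omega))
    have h2 : (4 : ℝ) ^ k ≤ (1 + |x - I.center| / I.length) ^ 2 := by
      calc (4 : ℝ) ^ k = (2 ^ k) ^ 2 := by rw [← pow_mul, mul_comm, pow_mul]; norm_num
        _ ≤ _ := by gcongr; linarith
    calc ((1 + |x - I.center| / I.length) ^ 2)⁻¹ ≤ ((4 : ℝ) ^ k)⁻¹ := by gcongr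
      _ = _ := by rw [pow_succ]; field_simp

/-- The density bound holds for balls centred at x₀, so each dyadic ball about c(I) is enlarged to
one about x₀. The enlargement costs at most 2 · bracket(x₀) relative to 2^j, and the terms decay
like 2^(-j). -/
theorem setLIntegral_bracket_le {F : Set ℝ} (hFfin : volume F < ∞)
    (I : DyadicInterval) {x₀ : ℝ} (hx₀ : x₀ ∉ exceptionalSet F) :
    ∫⁻ x in F, ENNReal.ofReal ((I.bracket x ^ 2)⁻¹) ≤
      ENNReal.ofReal (800 * I.length * I.bracket x₀ * volume.real F) := by
  have hI := I.length_pos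
  have hl := I.one_le_bracket x₀
  have hF0 : 0 ≤ volume.real F := measureReal_nonneg
  have hball : ∀ j : ℕ, volume (F ∩ Metric.ball I.center (2 ^ j * I.length)) ≤
      ENNReal.ofReal (50 * volume.real F * ((2 ^ j + I.bracket x₀) * I.length)) := by
    intro j
    have hsub : Metric.ball I.center (2 ^ j * I.length) ⊆
        Metric.ball x₀ ((2 ^ j + I.bracket x₀) * I.length) := by
      refine Metric.ball_subset_ball' ?_
      rw [dist_comm, Real.dist_eq, add_mul]
      have : I.bracket x₀ * I.length = I.length + |x₀ - I.center| := by
        unfold DyadicInterval.bracket; field_simp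
      linarith
    refine (measure_mono (Set.inter_subset_inter_right F hsub)).trans ?_
    have hfin : volume (F ∩ Metric.ball x₀ ((2 ^ j + I.bracket x₀) * I.length)) ≠ ∞ :=
      ((measure_mono Set.inter_subset_left).trans_lt hFfin).ne
    rw [← ENNReal.ofReal_toReal hfin]
    exact ENNReal.ofReal_le_ofReal (measureReal_inter_ball_le hx₀ (by positivity))
  calc ∫⁻ x in F, ENNReal.ofReal ((I.bracket x ^ 2)⁻¹)
      ≤ ∫⁻ x in F, ∑' j : ℕ, ENNReal.ofReal (4 * (4 ^ j)⁻¹) *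
        (Metric.ball I.center (2 ^ j * I.length)).indicator 1 x :=
        lintegral_mono fun x => ofReal_inv_bracket_sq_le I x
    _ = ∑' j : ℕ, ENNReal.ofReal (4 * (4 ^ j)⁻¹) *
        volume (F ∩ Metric.ball I.center (2 ^ j * I.length)) := by
        rw [lintegral_tsum fun j =>
          ((measurable_one.indicator measurableSet_ball).const_mul _).aemeasurable]
        refine tsum_congr fun j => ?_
        rw [lintegral_const_mul _ (measurable_one.indicator measurableSet_ball),
          lintegral_indicator_one measurableSet_ball, Measure.restrict_apply measurableSet_ball,
          Set.inter_comm]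
    _ ≤ ∑' j : ℕ, ENNReal.ofReal (400 * I.length * I.bracket x₀ * volume.real F * (1 / 2) ^ j) := by
        refine ENNReal.tsum_le_tsum fun j => ?_
        refine (mul_le_mul_right (hball j) _).trans ?_
        rw [← ENNReal.ofReal_mul (by positivity)]
        refine ENNReal.ofReal_le_ofReal ?_
        have h2 : (2 : ℝ) ^ j + I.bracket x₀ ≤ 2 * (I.bracket x₀ * 2 ^ j) := by
          have : (1 : ℝ) ≤ 2 ^ j := one_le_pow₀ (by norm_num)
          nlinarith
        have h4 : ((4 : ℝ) ^ j)⁻¹ = (1 / 2) ^ j * (2 ^ j)⁻¹ := by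
          rw [one_div, inv_pow, ← mul_inv, ← mul_pow]; norm_num
        calc 4 * ((4 : ℝ) ^ j)⁻¹ * (50 * volume.real F * ((2 ^ j + I.bracket x₀) * I.length))
            ≤ 4 * ((4 : ℝ) ^ j)⁻¹ * (50 * volume.real F *
              ((2 * (I.bracket x₀ * 2 ^ j)) * I.length)) := by gcongr
          _ = _ := by rw [h4]; field_simp; ring
    _ = _ := by
        rw [← ENNReal.ofReal_tsum_of_nonneg (fun j => by positivity)
          ((summable_geometric_of_lt_one (by norm_num) (by norm_num)).mul_left _), tsum_mul_left,
          tsum_geometric_of_lt_one (by norm_num) (by norm_num)]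
        congr 1; ring

/-! ### Remoteness and pointwise coefficient bounds -/

/-- The distance of `I` from the complement of `E`, in units of `|I|`. -/
noncomputable def remoteness (E : Set ℝ) (I : DyadicInterval) : ℝ :=
  1 + Metric.infDist I.center Eᶜ / I.length

section Remoteness

variable {E : Set ℝ} {I J : DyadicInterval}

theorem one_le_remoteness (E : Set ℝ) (I : DyadicInterval) : 1 ≤ remoteness E I := by
  have := I.length_pos
  have h : 0 ≤ Metric.infDist I.center Eᶜ := Metric.infDist_nonneg
  have : 0 ≤ Metric.infDist I.center Eᶜ / I.length := by positivity
  unfold remoteness; linarith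

theorem remoteness_le_bracket {x : ℝ} (hx : x ∉ E) : remoteness E I ≤ I.bracket x := by
  have := I.length_pos
  unfold remoteness DyadicInterval.bracket
  gcongr
  have := Metric.infDist_le_dist_of_mem (x := I.center) (show x ∈ Eᶜ from hx)
  rwa [dist_comm, Real.dist_eq] at this

/-- The complement of E is closed, so the distance is attained. This turns estimates at a point
outside E into estimates by remoteness. -/
theorem exists_bracket_eq_remoteness (hE : IsOpen E) (hne : Eᶜ.Nonempty) (I : DyadicInterval) :
    ∃ x ∉ E, I.bracket x = remoteness E I := by
  obtain ⟨x, hx, h⟩ := hE.isClosed_compl.exists_infDist_eq_dist hne I.center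
  refine ⟨x, hx, ?_⟩
  rw [remoteness, h, dist_comm, Real.dist_eq, DyadicInterval.bracket]

theorem remoteness_le_of_le (hE : IsOpen E) (hne : Eᶜ.Nonempty) (h : J ≤ I) :
    remoteness E I ≤ 2 * remoteness E J := by
  obtain ⟨x, hx, hxe⟩ := exists_bracket_eq_remoteness hE hne J
  rw [← hxe]
  exact (remoteness_le_bracket hx).trans (DyadicInterval.bracket_le_of_le h x)

/-- When |F| ≥ 1 the total mass of the weight suffices; otherwise the density bound is applied at a
nearest point outside E. -/
theorem setLIntegral_bracket_le_remoteness (hE : IsOpen E) (hne : Eᶜ.Nonempty) {F : Set ℝ}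
    (hFfin : volume F < ∞) (hFE : exceptionalSet F ⊆ E)
    (I : DyadicInterval) :
    ∫⁻ x in F, ENNReal.ofReal ((I.bracket x ^ 2)⁻¹) ≤
      ENNReal.ofReal (800 * I.length * remoteness E I * min 1 (volume.real F)) := by
  have hI := I.length_pos
  have hl := one_le_remoteness E I
  obtain ⟨x, hx, hxe⟩ := exists_bracket_eq_remoteness hE hne I
  rcases le_total 1 (volume.real F) with h | h
  · rw [min_eq_left h]
    refine (setLIntegral_le_lintegral _ _).trans
      ((lintegral_decay_le I.length_pos I.center).trans (ENNReal.ofReal_le_ofReal ?_))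
    nlinarith
  · rw [min_eq_right h, ← hxe]
    exact setLIntegral_bracket_le hFfin I fun hx' => hx (hFE hx')

end Remoteness

section Bounded

variable {f : ℝ → ℂ} {F E : Set ℝ}

theorem memLp_of_le_indicator (hF : MeasurableSet F) (hFfin : volume F < ∞)
    (hfm : AEStronglyMeasurable f volume) (hf : ∀ᵐ x, ‖f x‖ ≤ F.indicator 1 x) : MemLp f 2 := by
  refine (memLp_indicator_const 2 hF (1 : ℝ) (Or.inr hFfin.ne)).of_le hfm ?_
  filter_upwards [hf] with x hx
  refine hx.trans_eq ?_
  by_cases h : x ∈ F <;> simp [h]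

theorem integral_sq_mul_le {w : ℝ → ℝ} {c : ℝ} (hc : 0 ≤ c) (hw : ∀ x, 0 ≤ w x)
    (hF : MeasurableSet F)
    (hf : ∀ᵐ x, ‖f x‖ ≤ F.indicator 1 x)
    (hwF : ∫⁻ x in F, ENNReal.ofReal (w x) ≤ ENNReal.ofReal c) :
    ∫ x, ‖f x‖ ^ 2 * w x ≤ c := by
  by_cases hi : Integrable fun x => ‖f x‖ ^ 2 * w x
  · rw [integral_eq_lintegral_of_nonneg_ae
      (Filter.Eventually.of_forall fun x => mul_nonneg (by positivity) (hw x)) hi.1]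
    refine ENNReal.toReal_le_of_le_ofReal hc (le_trans ?_ hwF)
    rw [← lintegral_indicator hF]
    refine lintegral_mono_ae ?_
    filter_upwards [hf] with x hx
    by_cases h : x ∈ F
    · rw [Set.indicator_of_mem h] at hx ⊢
      refine ENNReal.ofReal_le_ofReal (mul_le_of_le_one_left (hw x) ?_)
      exact pow_le_one₀ (norm_nonneg _) hx
    · rw [Set.indicator_of_notMem h] at hx ⊢
      rw [le_antisymm hx (norm_nonneg _)]
      simp
  · rw [integral_undef hi]; exact hc

theorem integral_sq_le (hF : MeasurableSet F) (hFfin : volume F < ∞)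
    (hf : ∀ᵐ x, ‖f x‖ ≤ F.indicator 1 x) : ∫ x, ‖f x‖ ^ 2 ≤ volume.real F := by
  have := integral_sq_mul_le (w := fun _ => 1) (c := volume.real F) measureReal_nonneg
    (fun _ => zero_le_one) hF hf (by
      simp only [ENNReal.ofReal_one, setLIntegral_one]
      exact (ENNReal.ofReal_toReal hFfin.ne).ge)
  simpa using this

theorem norm_pairing_le_remoteness (hE : IsOpen E) (hne : Eᶜ.Nonempty) (hF : MeasurableSet F)
    (hFfin : volume F < ∞) (hFE : exceptionalSet F ⊆ E)
    (hf : ∀ᵐ x, ‖f x‖ ≤ F.indicator 1 x) {D : ℝ} {I ω : DyadicInterval} {φ : ℝ → ℂ}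
    (hφ : IsPacket D I ω φ) :
    ‖pairing f φ‖ ≤ √I.length * (800 * D * remoteness E I * min 1 (volume.real F)) := by
  have hD := hφ.nonneg
  have hI := I.length_pos
  have hs := Real.sqrt_pos.2 hI
  have hl := one_le_remoteness E I
  have hm : 0 ≤ min 1 (volume.real F) := le_min zero_le_one measureReal_nonneg
  have h1 : ‖pairing f φ‖ₑ ≤ ENNReal.ofReal
      (√I.length * (800 * D * remoteness E I * min 1 (volume.real F))) := by
    calc ‖pairing f φ‖ₑ ≤ ∫⁻ x, ‖f x‖ₑ * ‖φ x‖ₑ := enorm_pairing_le f φ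
      _ ≤ ∫⁻ x, F.indicator (fun x => ENNReal.ofReal (D * (√I.length)⁻¹) *
            ENNReal.ofReal ((I.bracket x ^ 2)⁻¹)) x := by
          refine lintegral_mono_ae ?_
          filter_upwards [hf] with x hx
          by_cases h : x ∈ F
          · rw [Set.indicator_of_mem h] at hx ⊢
            rw [← ofReal_norm, ← ofReal_norm, ← ENNReal.ofReal_mul (norm_nonneg _),
              ← ENNReal.ofReal_mul (by positivity)]
            refine ENNReal.ofReal_le_ofReal ?_
            have h3 := I.one_le_bracket x
            calc ‖f x‖ * ‖φ x‖ ≤ 1 * (D * (√I.length)⁻¹ * (I.bracket x ^ 10)⁻¹) := by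
                  gcongr
                  · exact hx
                  · exact hφ.bound x
              _ ≤ _ := by
                  rw [one_mul]
                  gcongr
                  norm_num
          · rw [Set.indicator_of_notMem h] at hx ⊢
            rw [norm_le_zero_iff.1 hx]
            simp
      _ ≤ ENNReal.ofReal (D * (√I.length)⁻¹) *
            ENNReal.ofReal (800 * I.length * remoteness E I * min 1 (volume.real F)) := by
          rw [lintegral_indicator hF, lintegral_const_mul' _ _ ENNReal.ofReal_ne_top]
          exact mul_le_mul_right (setLIntegral_bracket_le_remoteness hE hne hFfin hFE I) _
      _ = _ := by
          rw [← ENNReal.ofReal_mul (by positivity)]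
          congr 1
          rw [show D * (√I.length)⁻¹ * (800 * I.length * remoteness E I * min 1 (volume.real F)) =
            (I.length / √I.length) * (800 * D * remoteness E I * min 1 (volume.real F)) by ring,
            Real.div_sqrt]
  rw [← ofReal_norm] at h1
  exact (ENNReal.ofReal_le_ofReal_iff (by positivity)).1 h1

end Bounded

/-! ### Layers and columns: the estimate for the first two coefficients -/

/-- A two-sided geometric sum over dyadic scales. -/
theorem exists_sum_dyadic_le {δ : ℝ} (hδ : 0 < δ) : ∃ K : ℝ, 0 ≤ K ∧ ∀ Y : ℝ, 0 ≤ Y →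
    ∀ T : Finset ℤ,
      ∑ n ∈ T, ((2 : ℝ) ^ n) ^ δ * min 1 ((Y / (2 : ℝ) ^ n) ^ (2 * δ)) ≤ K * Y ^ δ := by
  set q : ℝ := 2 ^ (-δ) with hq
  have hq0 : 0 < q := by positivity
  have hq1 : q < 1 := Real.rpow_lt_one_of_one_lt_of_neg one_lt_two (neg_lt_zero.2 hδ)
  have hsum : Summable fun k : ℤ => q ^ k.natAbs := by
    refine Summable.of_nat_of_neg ?_ ?_ <;> simpa using summable_geometric_of_lt_one hq0.le hq1
  refine ⟨2 ^ δ * ∑' k : ℤ, q ^ k.natAbs,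
    mul_nonneg (Real.rpow_nonneg zero_le_two δ) (tsum_nonneg fun k => pow_nonneg hq0.le _),
    fun Y hY T => ?_⟩
  rcases hY.eq_or_lt with h0 | h0
  · rw [← h0]
    have h2 : (0 : ℝ) ^ (2 * δ) = 0 := Real.zero_rpow (by positivity)
    simp [h2, Real.zero_rpow hδ.ne']
  obtain ⟨m, hm1, hm2⟩ := exists_mem_Ico_zpow h0 (one_lt_two : (1 : ℝ) < 2)
  have hpow : ∀ k : ℕ, q ^ k = (((2 : ℝ) ^ k)⁻¹) ^ δ := fun k => by
    rw [hq, Real.rpow_neg zero_le_two, inv_pow, Real.inv_rpow (by positivity),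
      ← Real.rpow_natCast, ← Real.rpow_natCast, ← Real.rpow_mul zero_le_two,
      ← Real.rpow_mul zero_le_two, mul_comm]
  -- With 2^m ≤ Y < 2^(m+1), the terms decay geometrically away from m: below m through the power of
  -- 2^n, above m because the minimum overcompensates that power.
  have key : ∀ n : ℤ, ((2 : ℝ) ^ n) ^ δ * min 1 ((Y / (2 : ℝ) ^ n) ^ (2 * δ)) ≤
      2 ^ δ * Y ^ δ * q ^ (n - m).natAbs := by
    intro n
    have hn : (0 : ℝ) < 2 ^ n := by positivity
    rcases le_total n m with h | h
    · have e : (2 : ℝ) ^ n = 2 ^ m * (2 ^ (n - m).natAbs)⁻¹ := by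
        rw [← zpow_natCast, ← zpow_neg, ← zpow_add₀ two_ne_zero]
        congr 1; omega
      calc _ ≤ ((2 : ℝ) ^ n) ^ δ * 1 := by gcongr; exact min_le_left _ _
        _ = ((2 : ℝ) ^ m) ^ δ * q ^ (n - m).natAbs := by
          rw [mul_one, e, Real.mul_rpow (by positivity) (by positivity), hpow]
        _ ≤ (1 * Y ^ δ) * q ^ (n - m).natAbs := by rw [one_mul]; gcongr
        _ ≤ _ := by gcongr; exact Real.one_le_rpow one_le_two hδ.le
    · have e : (2 : ℝ) ^ m = 2 ^ n * (2 ^ (n - m).natAbs)⁻¹ := by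
        rw [← zpow_natCast, ← zpow_neg, ← zpow_add₀ two_ne_zero]
        congr 1; omega
      have e2 : Y / 2 ^ n ≤ 2 * (2 ^ (n - m).natAbs)⁻¹ := by
        rw [div_le_iff₀ hn]
        refine hm2.le.trans_eq ?_
        rw [zpow_add_one₀ two_ne_zero, e]; ring
      calc _ ≤ ((2 : ℝ) ^ n) ^ δ * (Y / (2 : ℝ) ^ n) ^ (2 * δ) := by
            gcongr; exact min_le_right _ _
        _ = Y ^ δ * (Y / 2 ^ n) ^ δ := by
          rw [two_mul, Real.rpow_add (by positivity), ← mul_assoc,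
            ← Real.mul_rpow hn.le (by positivity), mul_div_cancel₀ _ hn.ne']
        _ ≤ Y ^ δ * (2 * (2 ^ (n - m).natAbs)⁻¹) ^ δ := by gcongr
        _ = _ := by
          rw [Real.mul_rpow zero_le_two (by positivity), ← hpow]; ring
  have hsum' : Summable fun n : ℤ => q ^ (n - m).natAbs :=
    hsum.comp_injective (i := fun n : ℤ => n - m) fun _ _ h => sub_left_injective h
  have htsum : ∑' n : ℤ, q ^ (n - m).natAbs = ∑' k : ℤ, q ^ k.natAbs :=
    (Equiv.subRight m).tsum_eq fun k : ℤ => q ^ k.natAbs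
  calc _ ≤ ∑ n ∈ T, 2 ^ δ * Y ^ δ * q ^ (n - m).natAbs := Finset.sum_le_sum fun n _ => key n
    _ = 2 ^ δ * Y ^ δ * ∑ n ∈ T, q ^ (n - m).natAbs := (Finset.mul_sum _ _ _).symm
    _ ≤ 2 ^ δ * Y ^ δ * ∑' n : ℤ, q ^ (n - m).natAbs := by
        exact mul_le_mul_of_nonneg_left (hsum'.sum_le_tsum _ fun n _ => pow_nonneg hq0.le _)
          (by positivity)
    _ = _ := by rw [htsum]; ring

/-- A family of bi-tiles with wave packets, whose frequency squares are pairwise disjoint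
or equal. -/
structure IsBitileFamily {ι : Type*} (D : ℝ) (S : Finset ι) (I ω₁ ω₂ : ι → DyadicInterval)
    (φ₁ φ₂ : ι → ℝ → ℂ) : Prop where
  packet₁ : ∀ s ∈ S, IsPacket D (I s) (ω₁ s) (φ₁ s)
  packet₂ : ∀ s ∈ S, IsPacket D (I s) (ω₂ s) (φ₂ s)
  area₁ : ∀ s ∈ S, (I s).length * (ω₁ s).length = 1
  area₂ : ∀ s ∈ S, (I s).length * (ω₂ s).length = 1
  disjoint : ∀ s ∈ S, ∀ t ∈ S, s ≠ t → Disjoint (ω₁ s).toSet (ω₁ t).toSet ∨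
    Disjoint (ω₂ s).toSet (ω₂ t).toSet ∨
    (ω₁ s = ω₁ t ∧ ω₂ s = ω₂ t ∧ Disjoint (I s).toSet (I t).toSet)

namespace IsBitileFamily

variable {ι : Type*} {D : ℝ} {S : Finset ι} {I ω₁ ω₂ : ι → DyadicInterval}
  {φ₁ φ₂ : ι → ℝ → ℂ}

theorem swap (h : IsBitileFamily D S I ω₁ ω₂ φ₁ φ₂) : IsBitileFamily D S I ω₂ ω₁ φ₂ φ₁ where
  packet₁ := h.packet₂
  packet₂ := h.packet₁
  area₁ := h.area₂
  area₂ := h.area₁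
  disjoint s hs t ht hst := by
    rcases h.disjoint s hs t ht hst with h | h | h
    · exact Or.inr (Or.inl h)
    · exact Or.inl h
    · exact Or.inr (Or.inr ⟨h.2.1, h.1, h.2.2⟩)

theorem mono (h : IsBitileFamily D S I ω₁ ω₂ φ₁ φ₂) {T : Finset ι} (hT : T ⊆ S) :
    IsBitileFamily D T I ω₁ ω₂ φ₁ φ₂ where
  packet₁ s hs := h.packet₁ s (hT hs)
  packet₂ s hs := h.packet₂ s (hT hs)
  area₁ s hs := h.area₁ s (hT hs)
  area₂ s hs := h.area₂ s (hT hs)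
  disjoint s hs t ht := h.disjoint s (hT hs) t (hT ht)

/-- The estimate for one layer, in which the first coefficients are comparable: the family is
decomposed into columns whose tops are the maximal first tiles. -/
theorem layer_estimate (h : IsBitileFamily D S I ω₁ ω₂ φ₁ φ₂) {E F G : Set ℝ} (hE : IsOpen E)
    (hne : Eᶜ.Nonempty) (hF : MeasurableSet F) (hFfin : volume F < ∞)
    (hG : MeasurableSet G) (hGfin : volume G < ∞) (hGE : exceptionalSet G ⊆ E)
    {f g : ℝ → ℂ} (hfm : AEStronglyMeasurable f volume) (hgm : AEStronglyMeasurable g volume)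
    (hf : ∀ᵐ x, ‖f x‖ ≤ F.indicator 1 x) (hg : ∀ᵐ x, ‖g x‖ ≤ G.indicator 1 x)
    {κ : ℝ} (hκ : 0 ≤ κ) (hlow : ∀ s ∈ S, κ * √(I s).length ≤ ‖pairing f (φ₁ s)‖)
    (hup : ∀ s ∈ S, ‖pairing f (φ₁ s)‖ ≤ 2 * κ * √(I s).length) :
    κ ^ 2 * ∑ s ∈ S, ‖pairing g (φ₂ s)‖ ^ 2 * (remoteness E (I s))⁻¹ ≤
      2 ^ 30 * D ^ 4 * volume.real F * min 1 (volume.real G) := by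
  classical
  have hm0 : 0 ≤ min 1 (volume.real G) := le_min zero_le_one measureReal_nonneg
  rcases S.eq_empty_or_nonempty with rfl | ⟨s₀, hs₀⟩
  · have : 0 ≤ volume.real F := measureReal_nonneg
    simp only [Finset.sum_empty, mul_zero]
    positivity
  have : Nonempty ι := ⟨s₀⟩
  -- The tile order: s lies below t when I_s ⊆ I_t and ω_t ⊆ ω_s. Passing to the image identifies
  -- bi-tiles with the same first tile, so distinct maximal elements are disjoint tiles.
  let τ : ι → DyadicInterval × DyadicIntervalᵒᵈ := fun s => (I s, OrderDual.toDual (ω₁ s))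
  let P := S.image τ
  let M := P.filter fun m => Maximal (· ∈ P) m
  have hrep : ∀ m ∈ P, ∃ s ∈ S, τ s = m := fun m hm => Finset.mem_image.1 hm
  choose! ρ hρS hρ using hrep
  have hMP : ∀ m ∈ M, m ∈ P := fun m hm => (Finset.mem_filter.1 hm).1
  have hI : ∀ m ∈ M, I (ρ m) = m.1 := fun m hm => congrArg Prod.fst (hρ m (hMP m hm))
  have hω : ∀ m ∈ M, OrderDual.toDual (ω₁ (ρ m)) = m.2 :=
    fun m hm => congrArg Prod.snd (hρ m (hMP m hm))
  have hcover : ∀ s ∈ S, ∃ m ∈ M, τ s ≤ m := by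
    intro s hs
    obtain ⟨m, hm, hmax⟩ := P.exists_le_maximal (Finset.mem_image_of_mem τ hs)
    exact ⟨m, Finset.mem_filter.2 ⟨hmax.prop, hmax⟩, hm⟩
  have henergy : κ ^ 2 * ∑ m ∈ M, (I (ρ m)).length ≤ 256 * D ^ 2 * ∫ x, ‖f x‖ ^ 2 := by
    refine sum_length_le_of_disjoint_tiles M (fun m => I (ρ m)) (fun m => ω₁ (ρ m))
      (fun m => φ₁ (ρ m)) hκ (fun m hm => h.packet₁ _ (hρS m (hMP m hm)))
      (fun m hm => h.area₁ _ (hρS m (hMP m hm))) ?_ (memLp_of_le_indicator hF hFfin hfm hf)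
      (fun m hm => hlow _ (hρS m (hMP m hm))) (fun m hm => hup _ (hρS m (hMP m hm)))
    have key : ∀ m ∈ M, ∀ k ∈ M, (I (ρ m)).length ≤ (I (ρ k)).length → m ≠ k →
        Disjoint (I (ρ m)).toSet (I (ρ k)).toSet ∨
        Disjoint (ω₁ (ρ m)).toSet (ω₁ (ρ k)).toSet := by
      intro m hm k hk hl hmk
      by_contra! hcon
      have h1 := DyadicInterval.le_of_not_disjoint hl hcon.1
      have h2 : ω₁ (ρ k) ≤ ω₁ (ρ m) := by
        refine DyadicInterval.le_of_not_disjoint ?_ fun hd => hcon.2 hd.symm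
        rw [eq_inv_of_mul_eq_one_right (h.area₁ _ (hρS m (hMP m hm))),
          eq_inv_of_mul_eq_one_right (h.area₁ _ (hρS k (hMP k hk)))]
        exact inv_anti₀ (I (ρ m)).length_pos hl
      have hle : m ≤ k := by
        rw [← hρ m (hMP m hm), ← hρ k (hMP k hk)]
        exact ⟨h1, h2⟩
      exact hmk ((Finset.mem_filter.1 hm).2.eq_of_le (hMP k hk) hle)
    intro m hm k hk hmk
    rcases le_total (I (ρ m)).length (I (ρ k)).length with hl | hl
    · exact key m hm k hk hl hmk
    · exact (key k hk m hm hl hmk.symm).imp (fun h => h.symm) fun h => h.symm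
  -- All first frequency intervals in the column contain that of the top. This excludes the first
  -- alternative of `disjoint` and leaves the column hypothesis for the second packets.
  have hcol : ∀ m ∈ M, ∑ s ∈ S with τ s ≤ m,
      ‖pairing g (φ₂ s)‖ ^ 2 * (remoteness E (I s))⁻¹ ≤
      2 * 2048 * 800 * D ^ 2 * min 1 (volume.real G) * (I (ρ m)).length := by
    intro m hm
    have hle : ∀ s ∈ S.filter (fun s => τ s ≤ m), I s ≤ I (ρ m) ∧ ω₁ (ρ m) ≤ ω₁ s := by
      intro s hs
      have h1 := (Finset.mem_filter.1 hs).2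
      rw [← hρ m (hMP m hm)] at h1
      exact ⟨h1.1, h1.2⟩
    have hsub : S.filter (fun s => τ s ≤ m) ⊆ S := Finset.filter_subset _ _
    have hlm := zero_lt_one.trans_le (one_le_remoteness E (I (ρ m)))
    have hImp := (I (ρ m)).length_pos
    have hb := sum_norm_pairing_sq_le_of_column (S.filter fun s => τ s ≤ m) I ω₂ φ₂ (I (ρ m))
      (fun s hs => h.packet₂ s (hsub hs)) (fun s hs => (hle s hs).1) (fun s hs t ht hst => by
        rcases h.disjoint s (hsub hs) t (hsub ht) hst with h' | h' | h'
        · exact absurd (Set.disjoint_of_subset (hle s hs).2 (hle t ht).2 h')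
            (DyadicInterval.not_disjoint_of_le le_rfl)
        · exact Or.inl h'
        · refine Or.inr ⟨h'.2.1, ?_, h'.2.2⟩
          rw [eq_inv_of_mul_eq_one_left (h.area₂ s (hsub hs)),
            eq_inv_of_mul_eq_one_left (h.area₂ t (hsub ht)), h'.2.1])
      (memLp_of_le_indicator hG hGfin hgm hg)
    have hb2 := integral_sq_mul_le (w := fun x => ((I (ρ m)).bracket x ^ 2)⁻¹) (by positivity)
      (fun x => by positivity) hG hg
      (setLIntegral_bracket_le_remoteness hE hne hGfin hGE (I (ρ m)))
    -- Remoteness at the top is at most twice that of s, so the damping cancels the remoteness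
    -- factor in the integral of |g|² over the top.
    calc ∑ s ∈ S with τ s ≤ m, ‖pairing g (φ₂ s)‖ ^ 2 * (remoteness E (I s))⁻¹
        ≤ ∑ s ∈ S with τ s ≤ m, ‖pairing g (φ₂ s)‖ ^ 2 * (2 * (remoteness E (I (ρ m)))⁻¹) := by
          refine Finset.sum_le_sum fun s hs => ?_
          gcongr
          have h1 := remoteness_le_of_le hE hne (hle s hs).1
          have h2 := zero_lt_one.trans_le (one_le_remoteness E (I s))
          rw [← div_eq_mul_inv, inv_le_comm₀ h2 (by positivity), inv_div]
          linarith
      _ = (∑ s ∈ S with τ s ≤ m, ‖pairing g (φ₂ s)‖ ^ 2) *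
            (2 * (remoteness E (I (ρ m)))⁻¹) := by rw [Finset.sum_mul]
      _ ≤ (2048 * D ^ 2 * (800 * (I (ρ m)).length * remoteness E (I (ρ m)) *
            min 1 (volume.real G))) * (2 * (remoteness E (I (ρ m)))⁻¹) := by
          gcongr
          exact hb.trans (by gcongr)
      _ = _ := by field_simp
  have hx0 : ∀ s, 0 ≤ ‖pairing g (φ₂ s)‖ ^ 2 * (remoteness E (I s))⁻¹ := fun s =>
    mul_nonneg (by positivity) (inv_nonneg.2 (zero_le_one.trans (one_le_remoteness E (I s))))
  -- A bi-tile may lie below several tops; the terms are nonnegative, so counting it repeatedly is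
  -- harmless.
  have htot : ∑ s ∈ S, ‖pairing g (φ₂ s)‖ ^ 2 * (remoteness E (I s))⁻¹ ≤
      ∑ m ∈ M, ∑ s ∈ S with τ s ≤ m, ‖pairing g (φ₂ s)‖ ^ 2 * (remoteness E (I s))⁻¹ := by
    simp only [Finset.sum_filter]
    rw [Finset.sum_comm]
    refine Finset.sum_le_sum fun s hs => ?_
    obtain ⟨m, hm, hle⟩ := hcover s hs
    refine le_trans ?_ (Finset.single_le_sum (fun k _ => ?_) hm)
    · rw [if_pos hle]
    · split_ifs
      exacts [hx0 s, le_rfl]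
  have hint := integral_sq_le hF hFfin hf
  calc κ ^ 2 * ∑ s ∈ S, ‖pairing g (φ₂ s)‖ ^ 2 * (remoteness E (I s))⁻¹
      ≤ κ ^ 2 * ∑ m ∈ M, 2 * 2048 * 800 * D ^ 2 * min 1 (volume.real G) * (I (ρ m)).length := by
        gcongr
        exact htot.trans (Finset.sum_le_sum hcol)
    _ = 2 * 2048 * 800 * D ^ 2 * min 1 (volume.real G) *
          (κ ^ 2 * ∑ m ∈ M, (I (ρ m)).length) := by
        rw [← Finset.mul_sum]; ring
    _ ≤ 2 * 2048 * 800 * D ^ 2 * min 1 (volume.real G) * (256 * D ^ 2 * volume.real F) := by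
        exact mul_le_mul_of_nonneg_left (henergy.trans (by gcongr)) (by positivity)
    _ = (2 * 2048 * 800 * 256) * (D ^ 4 * volume.real F * min 1 (volume.real G)) := by ring
    _ ≤ 2 ^ 30 * (D ^ 4 * volume.real F * min 1 (volume.real G)) := by
        have : 0 ≤ volume.real F := measureReal_nonneg
        gcongr
        norm_num
    _ = _ := by ring

end IsBitileFamily

/-- The `ℓ^r` estimate for the products of the first two coefficients, damped by the remoteness:
the sum over the layers. -/
theorem exists_column_estimate {r : ℝ} (hr : 2 < r) {D : ℝ} (hD : 0 ≤ D) :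
    ∃ K : ℝ, 0 ≤ K ∧ ∀ {ι : Type} {S : Finset ι} {I ω₁ ω₂ : ι → DyadicInterval}
      {φ₁ φ₂ : ι → ℝ → ℂ}, IsBitileFamily D S I ω₁ ω₂ φ₁ φ₂ →
      ∀ {E F G : Set ℝ}, IsOpen E → Eᶜ.Nonempty → MeasurableSet F → volume F < ∞ →
      exceptionalSet F ⊆ E → MeasurableSet G → volume G < ∞ → exceptionalSet G ⊆ E →
      ∀ {f g : ℝ → ℂ}, AEStronglyMeasurable f volume → AEStronglyMeasurable g volume →
      (∀ᵐ x, ‖f x‖ ≤ F.indicator 1 x) → (∀ᵐ x, ‖g x‖ ≤ G.indicator 1 x) →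
      ∑ s ∈ S, (I s).length * ((‖pairing f (φ₁ s)‖ / √(I s).length) *
        (‖pairing g (φ₂ s)‖ / √(I s).length) * (remoteness E (I s) ^ 3)⁻¹) ^ r ≤
      K * (min 1 (volume.real F) ^ (r - 2) * volume.real F *
        (min 1 (volume.real G) ^ (r - 2) * min 1 (volume.real G))) := by
  classical
  have hδ : 0 < r - 2 := by linarith
  obtain ⟨K₀, hK₀, hgeom⟩ := exists_sum_dyadic_le hδ
  set C : ℝ := 800 * D with hC
  have hC0 : 0 ≤ C := by positivity
  refine ⟨2 ^ r * C ^ (r - 2) * (K₀ * C ^ (r - 2)) * (2 ^ 30 * D ^ 4), by positivity, ?_⟩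
  intro ι S I ω₁ ω₂ φ₁ φ₂ h E F G hE hne hF hFfin hFE hG hGfin hGE f g hfm hgm hf hg
  have hF0 : 0 ≤ volume.real F := measureReal_nonneg
  have hmF : 0 ≤ min 1 (volume.real F) := le_min zero_le_one hF0
  have hmG : 0 ≤ min 1 (volume.real G) := le_min zero_le_one measureReal_nonneg
  set mF := min 1 (volume.real F) with hmFd
  set mG := min 1 (volume.real G) with hmGd
  set a : ι → ℝ := fun s => ‖pairing f (φ₁ s)‖ / √(I s).length with ha
  set b : ι → ℝ := fun s => ‖pairing g (φ₂ s)‖ / √(I s).length with hb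
  set l : ι → ℝ := fun s => remoteness E (I s) with hl
  have ha0 : ∀ s, 0 ≤ a s := fun s => by positivity
  have hb0 : ∀ s, 0 ≤ b s := fun s => by positivity
  have hl1 : ∀ s, 1 ≤ l s := fun s => one_le_remoteness E (I s)
  have hsq : ∀ s, 0 < √(I s).length := fun s => Real.sqrt_pos.2 (I s).length_pos
  have haC : ∀ s ∈ S, a s ≤ C * l s * mF := fun s hs => by
    rw [ha, div_le_iff₀ (hsq s), mul_comm]
    exact norm_pairing_le_remoteness hE hne hF hFfin hFE hf (h.packet₁ s hs)
  have hbC : ∀ s ∈ S, b s ≤ C * l s * mG := fun s hs => by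
    rw [hb, div_le_iff₀ (hsq s), mul_comm]
    exact norm_pairing_le_remoteness hE hne hG hGfin hGE hg (h.packet₂ s hs)
  -- Vanishing coefficients have no dyadic size, and they contribute nothing to the sum.
  set S' := S.filter fun s => a s ≠ 0 with hS'
  have hS'S : S' ⊆ S := Finset.filter_subset _ _
  set n : ι → ℤ := fun s => Int.log 2 (a s) with hn
  have hapos : ∀ s ∈ S', 0 < a s := fun s hs =>
    lt_of_le_of_ne (ha0 s) (Finset.mem_filter.1 hs).2.symm
  have hn1 : ∀ s ∈ S', (2 : ℝ) ^ n s ≤ a s := fun s hs => by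
    exact_mod_cast Int.zpow_log_le_self one_lt_two (hapos s hs)
  have hn2 : ∀ s, a s ≤ 2 * (2 : ℝ) ^ n s := fun s => by
    have : a s < (2 : ℝ) ^ (n s + 1) := by
      exact_mod_cast Int.lt_zpow_succ_log_self one_lt_two (a s)
    rw [zpow_add_one₀ two_ne_zero, mul_comm] at this
    exact this.le
  have hrestrict : ∑ s ∈ S, (I s).length * (a s * b s * (l s ^ 3)⁻¹) ^ r =
      ∑ s ∈ S', (I s).length * (a s * b s * (l s ^ 3)⁻¹) ^ r := by
    refine (Finset.sum_subset hS'S fun s hs hs' => ?_).symm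
    have : a s = 0 := by
      by_contra h0
      exact hs' (Finset.mem_filter.2 ⟨hs, h0⟩)
    rw [this, zero_mul, zero_mul, Real.zero_rpow (by linarith), mul_zero]
  have hlayer : ∀ k : ℤ, ∑ s ∈ S' with n s = k, (I s).length * (a s * b s * (l s ^ 3)⁻¹) ^ r ≤
      2 ^ r * (C * mG) ^ (r - 2) * (2 ^ 30 * D ^ 4 * volume.real F * mG) *
        (((2 : ℝ) ^ k) ^ (r - 2) * min 1 ((C * mF / (2 : ℝ) ^ k) ^ (2 * (r - 2)))) := by
    intro k
    have hk : (0 : ℝ) < 2 ^ k := by positivity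
    set κ : ℝ := 2 ^ k with hκ
    have hsub : S'.filter (fun s => n s = k) ⊆ S' := Finset.filter_subset _ _
    have hlow : ∀ s ∈ S'.filter (fun s => n s = k), κ ≤ a s := fun s hs => by
      have := hn1 s (hsub hs)
      rwa [(Finset.mem_filter.1 hs).2] at this
    have hup : ∀ s ∈ S'.filter (fun s => n s = k), a s ≤ 2 * κ := fun s hs => by
      have := hn2 s
      rwa [(Finset.mem_filter.1 hs).2] at this
    have hest := (h.mono (hsub.trans hS'S)).layer_estimate hE hne hF hFfin hG hGfin hGE hfm hgm
      hf hg hk.le (fun s hs => (le_div_iff₀ (hsq s)).1 (hlow s hs))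
      (fun s hs => (div_le_iff₀ (hsq s)).1 (hup s hs))
    have hmin0 : 0 ≤ min 1 ((C * mF / κ) ^ (2 * (r - 2))) :=
      le_min zero_le_one (by positivity)
    have hpt : ∀ s ∈ S'.filter (fun s => n s = k),
        (I s).length * (a s * b s * (l s ^ 3)⁻¹) ^ r ≤
        2 ^ r * (C * mG) ^ (r - 2) * (κ ^ (r - 2) * min 1 ((C * mF / κ) ^ (2 * (r - 2)))) *
          (κ ^ 2 * (‖pairing g (φ₂ s)‖ ^ 2 * (l s)⁻¹)) := by
      intro s hs
      have hsS := hS'S (hsub hs)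
      have hls : 0 < l s := zero_lt_one.trans_le (hl1 s)
      have hb2 : (I s).length * b s ^ 2 = ‖pairing g (φ₂ s)‖ ^ 2 := by
        have := (I s).length_pos
        simp only [hb]
        rw [div_pow, Real.sq_sqrt this.le]
        field_simp
      have hbr : b s ^ r = b s ^ 2 * b s ^ (r - 2) := by
        rw [← Real.rpow_two, ← Real.rpow_add_of_nonneg (hb0 s) zero_le_two hδ.le]
        congr 1; ring
      have hκr : (2 * κ) ^ r = 2 ^ r * (κ ^ (r - 2) * κ ^ 2) := by
        rw [Real.mul_rpow zero_le_two hk.le, ← Real.rpow_two κ, ← Real.rpow_add hk]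
        congr 2; ring
      have hbδ : b s ^ (r - 2) ≤ (C * mG) ^ (r - 2) * l s ^ (r - 2) := by
        rw [← Real.mul_rpow (by positivity) hls.le]
        refine Real.rpow_le_rpow (hb0 s) ((hbC s hsS).trans_eq ?_) hδ.le
        ring
      -- Since κ ≤ a ≤ C λ mF, a layer with κ above C mF consists of remote tiles. The spare damping
      -- thereby becomes decay in κ, which makes the large layers summable.
      have hlmin : ((l s)⁻¹) ^ (2 * (r - 2)) ≤ min 1 ((C * mF / κ) ^ (2 * (r - 2))) := by
        refine le_min (Real.rpow_le_one (by positivity) (inv_le_one_of_one_le₀ (hl1 s))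
          (by positivity)) (Real.rpow_le_rpow (by positivity) ?_ (by positivity))
        rw [le_div_iff₀ hk, inv_mul_le_iff₀ hls]
        exact ((hlow s hs).trans (haC s hsS)).trans_eq (by ring)
      -- The cube is ample: the left exponent is -2r - 2, the right one -2r + 3. It pays for the
      -- growth of b^(r-2), for the one power in `layer_estimate`, and for the decay in κ.
      have hlr : l s ^ (r - 2) * ((l s ^ 3)⁻¹) ^ r ≤ (l s)⁻¹ * ((l s)⁻¹) ^ (2 * (r - 2)) := by
        have e1 : ((l s ^ 3)⁻¹) ^ r = l s ^ (-(3 * r)) := by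
          rw [Real.inv_rpow (by positivity), ← Real.rpow_natCast, ← Real.rpow_mul hls.le,
            ← Real.rpow_neg hls.le]
          norm_num
        have e2 : ((l s)⁻¹) ^ (2 * (r - 2)) = l s ^ (-(2 * (r - 2))) := by
          rw [Real.inv_rpow hls.le, ← Real.rpow_neg hls.le]
        rw [e1, e2, ← Real.rpow_neg_one, ← Real.rpow_add hls, ← Real.rpow_add hls]
        exact Real.rpow_le_rpow_of_exponent_le (hl1 s) (by linarith)
      have har : a s ^ r ≤ (2 * κ) ^ r :=
        Real.rpow_le_rpow (ha0 s) (hup s hs) (by linarith)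
      calc (I s).length * (a s * b s * (l s ^ 3)⁻¹) ^ r
          = a s ^ r * ((I s).length * b s ^ 2) * b s ^ (r - 2) * ((l s ^ 3)⁻¹) ^ r := by
            rw [Real.mul_rpow (mul_nonneg (ha0 s) (hb0 s)) (by positivity),
              Real.mul_rpow (ha0 s) (hb0 s), hbr]
            ring
        _ ≤ (2 * κ) ^ r * ‖pairing g (φ₂ s)‖ ^ 2 * ((C * mG) ^ (r - 2) * l s ^ (r - 2)) *
              ((l s ^ 3)⁻¹) ^ r := by
            rw [hb2]
            gcongr
        _ = 2 ^ r * (C * mG) ^ (r - 2) * (κ ^ (r - 2) * (κ ^ 2 * ‖pairing g (φ₂ s)‖ ^ 2)) *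
              (l s ^ (r - 2) * ((l s ^ 3)⁻¹) ^ r) := by
            rw [hκr]; ring
        _ ≤ 2 ^ r * (C * mG) ^ (r - 2) * (κ ^ (r - 2) * (κ ^ 2 * ‖pairing g (φ₂ s)‖ ^ 2)) *
              ((l s)⁻¹ * min 1 ((C * mF / κ) ^ (2 * (r - 2)))) := by
            exact mul_le_mul_of_nonneg_left (hlr.trans (by gcongr)) (by positivity)
        _ = _ := by ring
    refine (Finset.sum_le_sum hpt).trans ?_
    rw [← Finset.mul_sum, ← Finset.mul_sum]
    calc _ ≤ 2 ^ r * (C * mG) ^ (r - 2) *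
            (κ ^ (r - 2) * min 1 ((C * mF / κ) ^ (2 * (r - 2)))) *
            (2 ^ 30 * D ^ 4 * volume.real F * mG) :=
          mul_le_mul_of_nonneg_left hest (by positivity)
      _ = _ := by ring
  calc _ = ∑ s ∈ S', (I s).length * (a s * b s * (l s ^ 3)⁻¹) ^ r := hrestrict
    _ = ∑ k ∈ S'.image n, ∑ s ∈ S' with n s = k,
          (I s).length * (a s * b s * (l s ^ 3)⁻¹) ^ r :=
        (Finset.sum_fiberwise_of_maps_to (fun s hs => Finset.mem_image_of_mem n hs) _).symm
    _ ≤ ∑ k ∈ S'.image n, 2 ^ r * (C * mG) ^ (r - 2) * (2 ^ 30 * D ^ 4 * volume.real F * mG) *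
        (((2 : ℝ) ^ k) ^ (r - 2) * min 1 ((C * mF / (2 : ℝ) ^ k) ^ (2 * (r - 2)))) :=
        Finset.sum_le_sum fun k _ => hlayer k
    _ ≤ 2 ^ r * (C * mG) ^ (r - 2) * (2 ^ 30 * D ^ 4 * volume.real F * mG) *
          (K₀ * (C * mF) ^ (r - 2)) := by
        rw [← Finset.mul_sum]
        exact mul_le_mul_of_nonneg_left (hgeom (C * mF) (by positivity) _) (by positivity)
    _ = _ := by
        rw [Real.mul_rpow hC0 hmF, Real.mul_rpow hC0 hmG]; ring

/-! ### The estimate for the third coefficients -/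

/-- Hölder's inequality for the weighted average of `u` over the interval `I`. -/
theorem lintegral_mul_bracket_rpow_le {r r' : ℝ} (hrr' : r.HolderConjugate r')
    (I : DyadicInterval) {u : ℝ → ℝ≥0∞} (hu : AEMeasurable u) :
    (∫⁻ x, u x * ENNReal.ofReal ((I.bracket x ^ 2)⁻¹)) ^ r' ≤
      (∫⁻ x, u x ^ r' * ENNReal.ofReal ((I.bracket x ^ 2)⁻¹)) *
        ENNReal.ofReal (4 * I.length) ^ (r' - 1) := by
  have hw : Measurable fun x => ENNReal.ofReal ((I.bracket x ^ 2)⁻¹) :=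
    ENNReal.measurable_ofReal.comp (I.continuous_bracket.measurable.pow_const 2).inv
  -- Hölder against the constant 1 for the weighted measure, of mass at most 4|I|; the exponent r'/r
  -- equals r' - 1.
  set μ := (volume : Measure ℝ).withDensity fun x => ENNReal.ofReal ((I.bracket x ^ 2)⁻¹) with hμ
  have hac : AEMeasurable u μ := hu.mono_ac (withDensity_absolutelyContinuous _ _)
  have h1 := ENNReal.lintegral_mul_le_Lp_mul_Lq μ hrr'.symm hac
    (aemeasurable_const (b := (1 : ℝ≥0∞)))
  simp only [Pi.mul_apply, mul_one, ENNReal.one_rpow, lintegral_one] at h1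
  have h2 : μ Set.univ ≤ ENNReal.ofReal (4 * I.length) := by
    rw [hμ, withDensity_apply _ MeasurableSet.univ, setLIntegral_univ]
    exact lintegral_decay_le I.length_pos I.center
  rw [hμ, lintegral_withDensity_eq_lintegral_mul₀ hw.aemeasurable hu,
    lintegral_withDensity_eq_lintegral_mul₀ hw.aemeasurable (hu.pow_const r'), ← hμ] at h1
  simp only [Pi.mul_apply, mul_comm (ENNReal.ofReal _)] at h1
  have hr0 : 0 < r' := hrr'.symm.pos
  calc _ ≤ ((∫⁻ x, u x ^ r' * ENNReal.ofReal ((I.bracket x ^ 2)⁻¹)) ^ (1 / r') *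
          ENNReal.ofReal (4 * I.length) ^ (1 / r)) ^ r' := by
        refine ENNReal.rpow_le_rpow (h1.trans ?_) hr0.le
        gcongr
        exact one_div_nonneg.2 hrr'.pos.le
    _ = _ := by
        rw [ENNReal.mul_rpow_of_nonneg _ _ hr0.le, ← ENNReal.rpow_mul, ← ENNReal.rpow_mul,
          one_div_mul_cancel hr0.ne', ENNReal.rpow_one]
        congr 2
        have := hrr'.inv_add_inv_eq_one
        have h3 : r⁻¹ = 1 - r'⁻¹ := by linarith
        rw [one_div, h3, sub_mul, one_mul, inv_mul_cancel₀ hr0.ne']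

/-- The `ℓ^{r'}` estimate for the third coefficients. -/
theorem sum_third_coefficients_le {r r' : ℝ} (hrr' : r.HolderConjugate r') {D : ℝ} (hD : 0 ≤ D)
    {ι Ω : Type*} (S : Finset ι) (I : ι → DyadicInterval) (Q : ι → Ω) (W : Set Ω)
    (hQ : ∀ s ∈ S, Q s ∈ W)
    (hdis : ∀ s ∈ S, ∀ t ∈ S, s ≠ t → Q s = Q t →
      (I s).length = (I t).length ∧ Disjoint (I s).toSet (I t).toSet)
    (φ : ι → ℝ → ℂ) (hφ : ∀ s ∈ S, ∀ x,
      ‖φ s x‖ ≤ D * (√(I s).length)⁻¹ * ((I s).bracket x ^ 10)⁻¹)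
    (h : Ω → ℝ → ℂ) (hm : ∀ w ∈ W, AEStronglyMeasurable (h w) volume) {E H' : Set ℝ}
    (hH'm : MeasurableSet H') (hH' : Disjoint H' E) (hvol : volume H' ≤ 1)
    (hh : ∀ᵐ x, ∑' w : W, ‖h w x‖ₑ ^ r' ≤ H'.indicator 1 x) :
    ∑ s ∈ S, (I s).length * (‖pairing (h (Q s)) (φ s)‖ / √(I s).length *
      remoteness E (I s) ^ 3) ^ r' ≤ D ^ r' * 4 ^ (r' - 1) * 16 := by
  classical
  have hr0 : 0 < r' := hrr'.symm.pos
  have hr1 : 1 < r' := hrr'.symm.lt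
  -- H' avoids E and each term is at most the whole sum, so every h_ω vanishes almost everywhere on
  -- E.
  have hsupp : ∀ w ∈ W, ∀ᵐ x, x ∈ E → h w x = 0 := by
    intro w hw
    filter_upwards [hh] with x hx hxE
    rw [Set.indicator_of_notMem fun hxH => Set.disjoint_left.1 hH' hxH hxE] at hx
    have h1 := (ENNReal.le_tsum (f := fun w : W => ‖h w x‖ₑ ^ r') ⟨w, hw⟩).trans hx
    have h2 : ‖h w x‖ₑ ^ r' = 0 := le_antisymm h1 zero_le
    rwa [ENNReal.rpow_eq_zero_iff_of_pos hr0, enorm_eq_zero] at h2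
  have hone : ∀ s ∈ S, ENNReal.ofReal ((I s).length *
      (‖pairing (h (Q s)) (φ s)‖ / √(I s).length * remoteness E (I s) ^ 3) ^ r') ≤
      ENNReal.ofReal (D ^ r' * 4 ^ (r' - 1)) *
        ∫⁻ x, ‖h (Q s) x‖ₑ ^ r' * ENNReal.ofReal (((I s).bracket x ^ 2)⁻¹) := by
    intro s hs
    have hI := (I s).length_pos
    have hsq := Real.sqrt_pos.2 hI
    have hl1 := one_le_remoteness E (I s)
    have hl0 := zero_lt_one.trans_le hl1
    -- Off E the bracket dominates the remoteness. Of the ten powers of decay, three become the gain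
    -- λ^(-3) and two remain as an integrable weight.
    have h1 : ‖pairing (h (Q s)) (φ s)‖ₑ ≤
        ENNReal.ofReal (D * (√(I s).length)⁻¹ * (remoteness E (I s) ^ 3)⁻¹) *
        ∫⁻ x, ‖h (Q s) x‖ₑ * ENNReal.ofReal (((I s).bracket x ^ 2)⁻¹) := by
      refine (enorm_pairing_le _ _).trans ?_
      rw [← lintegral_const_mul' _ _ ENNReal.ofReal_ne_top]
      refine lintegral_mono_ae ?_
      filter_upwards [hsupp _ (hQ s hs)] with x hx
      by_cases hxE : x ∈ E
      · rw [hx hxE]; simp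
      rw [← mul_assoc, mul_comm (ENNReal.ofReal _) ‖h (Q s) x‖ₑ, mul_assoc]
      refine mul_le_mul_right ?_ _
      rw [← ENNReal.ofReal_mul (by positivity), ← ofReal_norm]
      refine ENNReal.ofReal_le_ofReal ((hφ s hs x).trans ?_)
      have h2 := remoteness_le_bracket (I := I s) hxE
      have h3 := (I s).one_le_bracket x
      have h4 := (I s).bracket_pos x
      rw [mul_assoc (D * _)]
      refine mul_le_mul_of_nonneg_left ?_ (by positivity)
      rw [← mul_inv]
      refine inv_anti₀ (by positivity) ?_
      calc remoteness E (I s) ^ 3 * (I s).bracket x ^ 2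
          ≤ (I s).bracket x ^ 3 * (I s).bracket x ^ 2 := by gcongr
        _ = (I s).bracket x ^ 5 := by ring
        _ ≤ _ := by gcongr; norm_num
    have h5 : ENNReal.ofReal (‖pairing (h (Q s)) (φ s)‖ / √(I s).length *
        remoteness E (I s) ^ 3) ≤ ENNReal.ofReal (D * (I s).length⁻¹) *
        ∫⁻ x, ‖h (Q s) x‖ₑ * ENNReal.ofReal (((I s).bracket x ^ 2)⁻¹) := by
      rw [div_mul_eq_mul_div, mul_div_assoc, ENNReal.ofReal_mul (norm_nonneg _), ofReal_norm]
      refine (mul_le_mul_left h1 _).trans_eq ?_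
      rw [mul_right_comm, ← ENNReal.ofReal_mul (by positivity)]
      congr 2
      nth_rewrite 3 [← Real.mul_self_sqrt hI.le]
      field_simp
    rw [ENNReal.ofReal_mul hI.le, ← ENNReal.ofReal_rpow_of_nonneg (by positivity) hr0.le]
    have hmeas : AEMeasurable (fun x => ‖h (Q s) x‖ₑ) := (hm _ (hQ s hs)).enorm
    calc _ ≤ ENNReal.ofReal (I s).length * (ENNReal.ofReal (D * (I s).length⁻¹) *
        ∫⁻ x, ‖h (Q s) x‖ₑ * ENNReal.ofReal (((I s).bracket x ^ 2)⁻¹)) ^ r' := by gcongr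
      _ ≤ ENNReal.ofReal (I s).length * (ENNReal.ofReal (D * (I s).length⁻¹) ^ r' *
          ((∫⁻ x, ‖h (Q s) x‖ₑ ^ r' * ENNReal.ofReal (((I s).bracket x ^ 2)⁻¹)) *
            ENNReal.ofReal (4 * (I s).length) ^ (r' - 1))) := by
          rw [ENNReal.mul_rpow_of_nonneg _ _ hr0.le]
          gcongr
          exact lintegral_mul_bracket_rpow_le hrr' (I s) hmeas
      _ = _ := by
          rw [← mul_assoc, mul_comm (∫⁻ x, _) _, ← mul_assoc]
          congr 1
          rw [ENNReal.ofReal_rpow_of_nonneg (by positivity) hr0.le,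
            ENNReal.ofReal_rpow_of_nonneg (by positivity) (by linarith),
            ← ENNReal.ofReal_mul hI.le, ← ENNReal.ofReal_mul (by positivity)]
          congr 1
          rw [Real.mul_rpow hD (by positivity), Real.mul_rpow (by norm_num) hI.le,
            Real.inv_rpow hI.le, Real.rpow_sub_one hI.ne']
          have : 0 < (I s).length ^ r' := by positivity
          field_simp
  -- For one square the spatial intervals are disjoint and of equal length, so their weights at x
  -- add up to at most 16; the squares are then summed by the ℓ^r' bound on h.
  have hpt : ∀ x, ∑ s ∈ S, ‖h (Q s) x‖ₑ ^ r' * ENNReal.ofReal (((I s).bracket x ^ 2)⁻¹) ≤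
      16 * ∑' w : W, ‖h w x‖ₑ ^ r' := by
    intro x
    rw [← Finset.sum_fiberwise_of_maps_to (fun s hs => Finset.mem_image_of_mem Q hs)]
    have h1 : ∀ w ∈ S.image Q, ∑ s ∈ S with Q s = w,
        ‖h (Q s) x‖ₑ ^ r' * ENNReal.ofReal (((I s).bracket x ^ 2)⁻¹) ≤ 16 * ‖h w x‖ₑ ^ r' := by
      intro w hw
      obtain ⟨s₀, hs₀, hs₀w⟩ := Finset.mem_image.1 hw
      have hlen : ∀ s ∈ S.filter (fun s => Q s = w), (I s).length = (I s₀).length := by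
        intro s hs
        by_cases he : s = s₀
        · rw [he]
        · exact (hdis s (Finset.mem_filter.1 hs).1 s₀ hs₀ he
            ((Finset.mem_filter.1 hs).2.trans hs₀w.symm)).1
      have h2 := sum_length_mul_decay_le (S.filter fun s => Q s = w) I (I s₀).length_pos
        (fun s hs => (hlen s hs).le) (fun s hs t ht hst => (hdis s (Finset.mem_filter.1 hs).1 t
          (Finset.mem_filter.1 ht).1 hst ((Finset.mem_filter.1 hs).2.trans
          (Finset.mem_filter.1 ht).2.symm)).2) x
      have h3 : ∀ s ∈ S.filter (fun s => Q s = w),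
          (I s).length * ((1 + |(I s).center - x| / (I s₀).length) ^ 2)⁻¹ =
          (I s₀).length * ((I s).bracket x ^ 2)⁻¹ := by
        intro s hs
        rw [DyadicInterval.bracket, hlen s hs, abs_sub_comm]
      rw [Finset.sum_congr rfl h3, ← Finset.mul_sum, mul_comm] at h2
      have h4 := le_of_mul_le_mul_right h2 (I s₀).length_pos
      calc _ = ∑ s ∈ S with Q s = w,
            ‖h w x‖ₑ ^ r' * ENNReal.ofReal (((I s).bracket x ^ 2)⁻¹) :=
            Finset.sum_congr rfl fun s hs => by rw [(Finset.mem_filter.1 hs).2]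
        _ = ‖h w x‖ₑ ^ r' *
            ENNReal.ofReal (∑ s ∈ S with Q s = w, ((I s).bracket x ^ 2)⁻¹) := by
            rw [← Finset.mul_sum, ENNReal.ofReal_sum_of_nonneg fun s _ => by positivity]
        _ ≤ ‖h w x‖ₑ ^ r' * 16 := by
            gcongr
            exact (ENNReal.ofReal_le_ofReal h4).trans_eq (by norm_num)
        _ = _ := mul_comm _ _
    refine (Finset.sum_le_sum h1).trans ?_
    rw [← Finset.mul_sum]
    gcongr
    rw [tsum_subtype W fun w => ‖h w x‖ₑ ^ r']
    refine le_trans (Finset.sum_le_sum fun w hw => ?_) (ENNReal.sum_le_tsum (S.image Q))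
    obtain ⟨s, hs, rfl⟩ := Finset.mem_image.1 hw
    rw [Set.indicator_of_mem (hQ s hs)]
  have hw : ∀ s, Measurable fun x => ENNReal.ofReal (((I s).bracket x ^ 2)⁻¹) := fun s =>
    ENNReal.measurable_ofReal.comp ((I s).continuous_bracket.measurable.pow_const 2).inv
  have htot : ∑ s ∈ S, ∫⁻ x, ‖h (Q s) x‖ₑ ^ r' * ENNReal.ofReal (((I s).bracket x ^ 2)⁻¹) ≤
      16 := by
    have hmeas : ∀ s ∈ S, AEMeasurable fun x =>
        ‖h (Q s) x‖ₑ ^ r' * ENNReal.ofReal (((I s).bracket x ^ 2)⁻¹) := fun s hs =>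
      ((hm _ (hQ s hs)).enorm.pow_const r').mul (hw s).aemeasurable
    rw [← lintegral_finsetSum' S hmeas]
    calc _ ≤ ∫⁻ x, 16 * H'.indicator 1 x := by
          refine lintegral_mono_ae ?_
          filter_upwards [hh] with x hx
          exact (hpt x).trans (mul_le_mul_right hx 16)
      _ = 16 * volume H' := by
          rw [lintegral_const_mul' _ _ (by norm_num), lintegral_indicator_one hH'm]
      _ ≤ 16 * 1 := by gcongr
      _ = 16 := mul_one _
  have hpos : ∀ s ∈ S, 0 ≤ (I s).length * (‖pairing (h (Q s)) (φ s)‖ / √(I s).length *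
      remoteness E (I s) ^ 3) ^ r' := fun s _ => by
    have := one_le_remoteness E (I s)
    have := (I s).length_pos
    positivity
  refine (ENNReal.ofReal_le_ofReal_iff (by positivity)).1 ?_
  rw [ENNReal.ofReal_sum_of_nonneg hpos]
  refine (Finset.sum_le_sum hone).trans ?_
  rw [← Finset.mul_sum, ENNReal.ofReal_mul (show 0 ≤ D ^ r' * 4 ^ (r' - 1) by positivity)]
  refine mul_le_mul_right (htot.trans_eq ?_) _
  norm_num

/-! ### Comparison of exponents -/

/-- The comparison of exponents in the restricted type estimate. -/
theorem rpow_bound_le {r r' p q x y : ℝ} (hr : 2 < r) (hrr' : r.HolderConjugate r')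
    (hp : r' < p) (hq : r' < q) (hpq : 1 / r ≤ 1 / p + 1 / q) (hx : 0 ≤ x) (hxy : x ≤ y) :
    (min 1 x ^ (r - 2) * x * (min 1 y ^ (r - 2) * min 1 y)) ^ (1 / r) ≤
      x ^ (1 / p) * y ^ (1 / q) := by
  have hy : 0 ≤ y := hx.trans hxy
  have hr0 : 0 < r := by linarith
  have hr'0 : 0 < r' := hrr'.symm.pos
  have hp0 : 0 < p := by linarith
  have hq0 : 0 < q := by linarith
  have hpr : 1 / p ≤ 1 / r' := one_div_le_one_div_of_le hr'0 hp.le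
  have hqr : 1 / q ≤ 1 / r' := one_div_le_one_div_of_le hr'0 hq.le
  have hexp : (r - 1) * (1 / r) = 1 / r' := by
    have := hrr'.inv_add_inv_eq_one
    rw [sub_mul, mul_one_div_cancel hr0.ne']
    simp only [one_div]
    linarith
  have hpow : ∀ z : ℝ, 0 ≤ z → z ^ (r - 2) * z = z ^ (r - 1) := fun z hz => by
    nth_rewrite 2 [← Real.rpow_one z]
    rw [← Real.rpow_add_of_nonneg hz (by linarith) zero_le_one]
    congr 1; ring
  -- For measures at most 1 the available exponent (r - 1)/r = 1/r' exceeds 1/p and 1/q.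
  have hsmall : ∀ z e : ℝ, 0 ≤ z → z ≤ 1 → 0 < e → e ≤ 1 / r' →
      (z ^ (r - 1)) ^ (1 / r) ≤ z ^ e := fun z e hz hz1 he he' => by
    rw [← Real.rpow_mul hz, hexp]
    exact Real.rpow_le_rpow_of_exponent_ge_of_imp hz hz1 he' fun _ h0 => absurd h0 (he.trans_le he').ne'
  have hp' : 0 < 1 / p := by positivity
  have hq' : 0 < 1 / q := by positivity
  rcases le_total y 1 with hy1 | hy1
  · rw [min_eq_right hy1, min_eq_right (hxy.trans hy1), hpow x hx, hpow y hy,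
      Real.mul_rpow (by positivity) (by positivity)]
    gcongr
    · exact hsmall x _ hx (hxy.trans hy1) hp' hpr
    · exact hsmall y _ hy hy1 hq' hqr
  -- If both measures are at least 1 only x^(1/r) remains. The condition 1/r ≤ 1/p + 1/q is used
  -- here, and x ≤ y moves part of the power onto y.
  · rw [min_eq_left hy1, Real.one_rpow, mul_one, mul_one]
    rcases le_total x 1 with hx1 | hx1
    · rw [min_eq_right hx1, hpow x hx, ← mul_one ((x ^ (r - 1)) ^ (1 / r))]
      gcongr
      · exact hsmall x _ hx hx1 hp' hpr
      · exact Real.one_le_rpow hy1 hq'.le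
    · rw [min_eq_left hx1, Real.one_rpow, one_mul]
      calc x ^ (1 / r) ≤ x ^ (1 / p + 1 / q) := Real.rpow_le_rpow_of_exponent_le hx1 hpq
        _ = x ^ (1 / p) * x ^ (1 / q) := Real.rpow_add (by linarith) _ _
        _ ≤ _ := by gcongr

/-! ### From wave packets and tri-tiles to abstract families -/

theorem IsAdapted.norm_le {C : ℝ} {I : DyadicInterval} {θ : ℝ} {φ : ℝ → ℂ}
    (h : IsAdapted C 1 I fun x => (√I.length : ℂ) * modulate θ φ x) (x : ℝ) :
    ‖φ x‖ ≤ 2 ^ 10 * |C| * (√I.length)⁻¹ * (I.bracket x ^ 10)⁻¹ := by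
  have hs := Real.sqrt_pos.2 I.length_pos
  have h1 := h.2 0 (Nat.zero_le 1) x
  rw [iteratedDeriv_zero, norm_mul, Complex.norm_real, Real.norm_of_nonneg hs.le, modulate,
    norm_mul, show 2 * (Real.pi : ℂ) * Complex.I * θ * x = (2 * Real.pi * θ * x : ℝ) * Complex.I by
      push_cast; ring, Complex.norm_exp_ofReal_mul_I, one_mul, pow_zero, inv_one, mul_one,
    pow_one] at h1
  have hchi : 0 ≤ I.chi x := by
    have : 0 ≤ Metric.infDist x I.toSet := Metric.infDist_nonneg
    have := I.length_pos
    unfold DyadicInterval.chi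
    positivity
  have h2 : √I.length * ‖φ x‖ ≤ |C| * (2 ^ 10 * (I.bracket x ^ 10)⁻¹) :=
    h1.trans (mul_le_mul (le_abs_self C) (I.chi_le x) hchi (abs_nonneg C))
  calc ‖φ x‖ = (√I.length)⁻¹ * (√I.length * ‖φ x‖) := by field_simp
    _ ≤ (√I.length)⁻¹ * (|C| * (2 ^ 10 * (I.bracket x ^ 10)⁻¹)) := by gcongr
    _ = _ := by ring

theorem IsAdapted.continuous {C : ℝ} {I : DyadicInterval} {θ : ℝ} {φ : ℝ → ℂ}
    (h : IsAdapted C 1 I fun x => (√I.length : ℂ) * modulate θ φ x) : Continuous φ := by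
  have hs : (√I.length : ℂ) ≠ 0 := by exact_mod_cast (Real.sqrt_pos.2 I.length_pos).ne'
  have h1 := h.1.continuous
  have h2 : φ = fun x : ℝ => (√I.length : ℂ)⁻¹ * Complex.exp (-(2 * Real.pi * Complex.I * θ * x)) *
      ((√I.length : ℂ) * modulate θ φ x) := by
    funext x
    rw [modulate, Complex.exp_neg]
    have := Complex.exp_ne_zero (2 * Real.pi * Complex.I * θ * x)
    field_simp
  rw [h2]
  exact Continuous.mul (by fun_prop) h1

theorem IsWavePacket.isPacket {C : ℝ} {P : Tile} {φ : ℝ → ℂ} (h : IsWavePacket 1 C 1 P φ) :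
    IsPacket (2 ^ 10 * |C|) P.space P.freq φ :=
  ⟨h.1.continuous, h.1.norm_le, h.2.2⟩

/-- The position of the third frequency interval of a tri-tile relative to the first two. -/
def Tritile.thirdOffset (s : Tritile) : ℤ := (s.freq 2).pos - (s.freq 0).pos - (s.freq 1).pos

theorem Tritile.freq_length (s : Tritile) (j : Fin 3) : (s.freq j).length = s.space.length⁻¹ :=
  eq_inv_of_mul_eq_one_right (s.area j)

/-- All three frequency intervals have the same length L, so the difference of centres is (offset -
1/2) L, the half coming from the midpoints. Hence only finitely many offsets occur, their number
depending on B alone. -/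
theorem Tritile.thirdOffset_mem {B : ℝ} {s : Tritile} (h : s.ThirdComparable B) :
    s.thirdOffset ∈ Finset.Icc ⌈1 / 2 - B⌉ ⌊1 / 2 + B⌋ := by
  have hL := (s.freq 0).length_pos
  have h1 : (s.freq 1).length = (s.freq 0).length := by rw [s.freq_length, s.freq_length]
  have h2 : (s.freq 2).length = (s.freq 0).length := by rw [s.freq_length, s.freq_length]
  have h3 : |(s.thirdOffset : ℝ) - 1 / 2| ≤ B := by
    refine le_of_mul_le_mul_right ?_ hL
    refine le_trans (le_of_eq ?_) h
    rw [DyadicInterval.center, DyadicInterval.center, DyadicInterval.center, h1, h2]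
    nth_rewrite 1 [← abs_of_pos hL]
    rw [← abs_mul]
    congr 1
    rw [thirdOffset]
    push_cast
    ring
  rw [abs_le] at h3
  rw [Finset.mem_Icc, Int.ceil_le, Int.le_floor]
  constructor <;> linarith [h3.1, h3.2]

theorem Tritile.ext_of_thirdOffset {s t : Tritile} (hI : s.space = t.space)
    (hsq : s.square = t.square) (ho : s.thirdOffset = t.thirdOffset) : s = t := by
  have h0 : s.freq 0 = t.freq 0 := congrArg DyadicSquare.fst hsq
  have h1 : s.freq 1 = t.freq 1 := congrArg DyadicSquare.snd hsq
  have h2 : s.freq 2 = t.freq 2 := by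
    have hsc : (s.freq 2).scale = (t.freq 2).scale := by
      rw [← DyadicInterval.length_eq_iff, s.freq_length, t.freq_length, hI]
    have hp : (s.freq 2).pos = (t.freq 2).pos := by
      rw [thirdOffset, thirdOffset, h0, h1] at ho
      linarith
    cases hs : s.freq 2
    cases ht : t.freq 2
    rw [hs, ht] at hsc hp
    simp_all
  have hf : s.freq = t.freq := by
    funext j
    fin_cases j
    exacts [h0, h1, h2]
  cases s; cases t
  simp only at hI hf
  subst hI hf
  rfl

/-- Two different tri-tiles with the same offset and the same square live on disjoint spatial
intervals of the same length. -/
theorem Tritile.space_disjoint {s t : Tritile} (hst : s ≠ t) (hsq : s.square = t.square)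
    (ho : s.thirdOffset = t.thirdOffset) :
    s.space.length = t.space.length ∧ Disjoint s.space.toSet t.space.toSet := by
  have hl : s.space.length = t.space.length := by
    have h0 : (s.freq 0).length = (t.freq 0).length :=
      congrArg (fun w : DyadicSquare => w.fst.length) hsq
    rwa [s.freq_length, t.freq_length, inv_inj] at h0
  refine ⟨hl, ?_⟩
  by_contra hd
  exact hst (Tritile.ext_of_thirdOffset (DyadicInterval.eq_of_not_disjoint hl hd) hsq ho)

theorem IsModel.mono {B C : ℝ} {N : ℕ} {W : Set DyadicSquare} {S T : Finset Tritile}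
    {φ : Tritile → Fin 3 → ℝ → ℂ} (h : IsModel B C N W S φ) (hT : T ⊆ S) :
    IsModel B C N W T φ :=
  ⟨h.disjoint, fun s hs => h.square_mem s (hT hs), fun s hs => h.third s (hT hs),
    fun s hs => h.packet s (hT hs)⟩

/-- Fixing the offset is what makes two distinct tri-tiles over the same square spatially disjoint;
without it they could differ in the third interval only. -/
theorem IsModel.isBitileFamily {B C : ℝ} {W : Set DyadicSquare} {S : Finset Tritile}
    {φ : Tritile → Fin 3 → ℝ → ℂ} (h : IsModel B C 1 W S φ) {d : ℤ}
    (hd : ∀ s ∈ S, s.thirdOffset = d) :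
    IsBitileFamily (2 ^ 10 * |C|) S Tritile.space (fun s => s.freq 0) (fun s => s.freq 1)
      (fun s => φ s 0) (fun s => φ s 1) where
  packet₁ s hs := (h.packet s hs 0).isPacket
  packet₂ s hs := (h.packet s hs 1).isPacket
  area₁ s _ := s.area 0
  area₂ s _ := s.area 1
  disjoint s hs t ht hst := by
    by_cases hsq : s.square = t.square
    · exact Or.inr (Or.inr ⟨congrArg DyadicSquare.fst hsq, congrArg DyadicSquare.snd hsq,
        (Tritile.space_disjoint hst hsq ((hd s hs).trans (hd t ht).symm)).2⟩)
    · have := h.disjoint (h.square_mem s hs) (h.square_mem t ht) hsq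
      rcases Set.disjoint_prod.1 this with h' | h'
      · exact Or.inl h'
      · exact Or.inr (Or.inl h')

/-! ### Assembly -/

/-- The estimate for the tri-tiles with a fixed offset. -/
theorem exists_modelForm_bound {r r' : ℝ} (hr : 2 < r) (hrr' : r.HolderConjugate r') (C : ℝ) :
    ∃ K : ℝ, 0 ≤ K ∧ ∀ {B : ℝ} {W : Set DyadicSquare} {S : Finset Tritile}
      {φ : Tritile → Fin 3 → ℝ → ℂ} {d : ℤ}, IsModel B C 1 W S φ →
      (∀ s ∈ S, s.thirdOffset = d) →
      ∀ {E F G H' : Set ℝ}, IsOpen E → Eᶜ.Nonempty → MeasurableSet F → volume F < ∞ →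
      exceptionalSet F ⊆ E → MeasurableSet G → volume G < ∞ → exceptionalSet G ⊆ E →
      MeasurableSet H' → Disjoint H' E → volume H' ≤ 1 →
      ∀ {f g : ℝ → ℂ} {h : DyadicSquare → ℝ → ℂ},
      AEStronglyMeasurable f volume → AEStronglyMeasurable g volume →
      (∀ w ∈ W, AEStronglyMeasurable (h w) volume) →
      (∀ᵐ x, ‖f x‖ ≤ F.indicator 1 x) → (∀ᵐ x, ‖g x‖ ≤ G.indicator 1 x) →
      (∀ᵐ x, ∑' w : W, ‖h w x‖ₑ ^ r' ≤ H'.indicator 1 x) →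
      ∀ {p q : ℝ}, r' < p → r' < q → 1 / r ≤ 1 / p + 1 / q →
      ‖modelForm S φ f g h‖ ≤ K * (volume.real F ^ (1 / p) * volume.real G ^ (1 / q)) := by
  have hr0 : 0 < r := by linarith
  have hr'0 : 0 < r' := hrr'.symm.pos
  have hD : 0 ≤ 2 ^ 10 * |C| := by positivity
  obtain ⟨K, hK, hcol⟩ := exists_column_estimate hr hD
  refine ⟨K ^ (1 / r) * ((2 ^ 10 * |C|) ^ r' * 4 ^ (r' - 1) * 16) ^ (1 / r'), by positivity, ?_⟩
  intro B W S φ d hmod hd E F G H' hE hne hF hFfin hFE hG hGfin hGE hH'm hH'E hH'v f g h hfm hgm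
    hhm hf hg hh p q hp hq hpq
  have hfam := hmod.isBitileFamily hd
  have hF0 : 0 ≤ volume.real F := measureReal_nonneg
  have hG0 : 0 ≤ volume.real G := measureReal_nonneg
  -- The factor λ^(-3) damps the coefficients of f and g, and the compensating λ^3 is afforded by h.
  set A : Tritile → ℝ := fun s => (‖pairing f (φ s 0)‖ / √s.space.length) *
        (‖pairing g (φ s 1)‖ / √s.space.length) * (remoteness E s.space ^ 3)⁻¹ with hA
  set Z : Tritile → ℝ := fun s => ‖pairing (h s.square) (φ s 2)‖ / √s.space.length *
      remoteness E s.space ^ 3 with hZ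
  have hl : ∀ s : Tritile, 0 < remoteness E s.space := fun s =>
    zero_lt_one.trans_le (one_le_remoteness E s.space)
  have hA0 : ∀ s, 0 ≤ A s := fun s => by have := hl s; positivity
  have hZ0 : ∀ s, 0 ≤ Z s := fun s => by have := hl s; positivity
  have hthird : ∑ s ∈ S, s.space.length * Z s ^ r' ≤
      (2 ^ 10 * |C|) ^ r' * 4 ^ (r' - 1) * 16 :=
    sum_third_coefficients_le hrr' hD S Tritile.space Tritile.square W hmod.square_mem
      (fun s hs t ht hst hsq => Tritile.space_disjoint hst hsq ((hd s hs).trans (hd t ht).symm))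
      (fun s => φ s 2) (fun s hs => (hmod.packet s hs 2).1.norm_le) h hhm hH'm hH'E hH'v hh
  have hpair : (∑ s ∈ S, s.space.length * A s ^ r) ^ (1 / r) ≤
      K ^ (1 / r) * (volume.real F ^ (1 / p) * volume.real G ^ (1 / q)) := by
    have hsum0 : 0 ≤ ∑ s ∈ S, s.space.length * A s ^ r := Finset.sum_nonneg fun s _ =>
      mul_nonneg s.space.length_pos.le (Real.rpow_nonneg (hA0 s) r)
    -- The energy inequality, which yields an untruncated measure, is applied to the function on the
    -- smaller set.
    rcases le_total (volume.real F) (volume.real G) with hFG | hFG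
    · have h1 := hcol hfam hE hne hF hFfin hFE hG hGfin hGE hfm hgm hf hg
      refine (Real.rpow_le_rpow hsum0 h1 (by positivity)).trans ?_
      rw [Real.mul_rpow hK (by positivity)]
      gcongr
      exact rpow_bound_le hr hrr' hp hq hpq hF0 hFG
    · have h1 := hcol hfam.swap hE hne hG hGfin hGE hF hFfin hFE hgm hfm hg hf
      simp only [mul_comm (‖pairing g _‖ / _)] at h1
      refine (Real.rpow_le_rpow hsum0 h1 (by positivity)).trans ?_
      rw [Real.mul_rpow hK (by positivity), mul_comm (volume.real F ^ (1 / p))]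
      gcongr
      exact rpow_bound_le hr hrr' hq hp (by linarith) hG0 hFG
  -- |I|^(-1/2) is |I| times the three normalizing factors |I|^(-1/2), and |I| splits as |I|^(1/r)
  -- |I|^(1/r').
  have hterm : ∀ s : Tritile, ‖((s.space.length ^ (-(1 / 2) : ℝ) : ℝ) : ℂ) *
      pairing f (φ s 0) * pairing g (φ s 1) * pairing (h s.square) (φ s 2)‖ =
      (s.space.length ^ (1 / r) * A s) * (s.space.length ^ (1 / r') * Z s) := by
    intro s
    have hL := s.space.length_pos
    have hsq := Real.sqrt_pos.2 hL
    have hls := hl s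
    have e1 : s.space.length ^ (1 / r) * s.space.length ^ (1 / r') = √s.space.length ^ 2 := by
      rw [← Real.rpow_add hL, Real.sq_sqrt hL.le, one_div, one_div, hrr'.inv_add_inv_eq_one,
        Real.rpow_one]
    have e2 : s.space.length ^ (-(1 / 2) : ℝ) = (√s.space.length)⁻¹ := by
      rw [Real.rpow_neg hL.le, Real.sqrt_eq_rpow]
    rw [norm_mul, norm_mul, norm_mul, Complex.norm_real, Real.norm_of_nonneg (by positivity), e2,
      mul_mul_mul_comm, e1]
    simp only [hA, hZ]
    field_simp
  have hpow : ∀ (s : Tritile) (e z : ℝ), 0 < e → 0 ≤ z →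
      (s.space.length ^ (1 / e) * z) ^ e = s.space.length * z ^ e := fun s e z he hz => by
    have hL := s.space.length_pos
    rw [Real.mul_rpow (by positivity) hz, ← Real.rpow_mul hL.le, one_div_mul_cancel he.ne',
      Real.rpow_one]
  calc ‖modelForm S φ f g h‖
      ≤ ∑ s ∈ S, (s.space.length ^ (1 / r) * A s) * (s.space.length ^ (1 / r') * Z s) := by
        refine (norm_sum_le _ _).trans (le_of_eq (Finset.sum_congr rfl fun s _ => hterm s))
    _ ≤ (∑ s ∈ S, (s.space.length ^ (1 / r) * A s) ^ r) ^ (1 / r) *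
          (∑ s ∈ S, (s.space.length ^ (1 / r') * Z s) ^ r') ^ (1 / r') :=
        Real.inner_le_Lp_mul_Lq_of_nonneg S hrr'
          (fun s _ => mul_nonneg (Real.rpow_nonneg s.space.length_pos.le _) (hA0 s))
          (fun s _ => mul_nonneg (Real.rpow_nonneg s.space.length_pos.le _) (hZ0 s))
    _ = (∑ s ∈ S, s.space.length * A s ^ r) ^ (1 / r) *
          (∑ s ∈ S, s.space.length * Z s ^ r') ^ (1 / r') := by
        simp only [hpow _ _ _ hr0 (hA0 _), hpow _ _ _ hr'0 (hZ0 _)]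
    _ ≤ (K ^ (1 / r) * (volume.real F ^ (1 / p) * volume.real G ^ (1 / q))) *
          ((2 ^ 10 * |C|) ^ r' * 4 ^ (r' - 1) * 16) ^ (1 / r') := by
        have : 0 ≤ ∑ s ∈ S, s.space.length * Z s ^ r' := Finset.sum_nonneg fun s _ =>
          mul_nonneg s.space.length_pos.le (Real.rpow_nonneg (hZ0 s) r')
        gcongr
    _ = _ := by ring

end BilinearRdF

open BilinearRdF

theorem proposition1p3 (r r' : ℝ) (hr : 2 < r) (hrr' : r.HolderConjugate r') :
    ∃ (N : ℝ → ℝ → ℕ) (K : ℝ → ℝ → ℝ → ℝ → ℝ),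
      ∀ F G H : Set ℝ, MeasurableSet F → MeasurableSet G → MeasurableSet H →
        volume F < ∞ → volume G < ∞ → volume H = 1 →
        ∃ H' : Set ℝ, MeasurableSet H' ∧ H' ⊆ H ∧ volume H / 2 < volume H' ∧
          ∀ p q s : ℝ, r' < p → r' < q → r' / 2 < s → s < r → 1 / p + 1 / q = 1 / s →
          ∀ (B C : ℝ) (W : Set BilinearRdF.DyadicSquare) (S : Finset BilinearRdF.Tritile)
            (φ : BilinearRdF.Tritile → Fin 3 → ℝ → ℂ),
            BilinearRdF.IsModel B C (N p q) W S φ →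
          ∀ (f g : ℝ → ℂ) (h : BilinearRdF.DyadicSquare → ℝ → ℂ),
            AEStronglyMeasurable f volume → AEStronglyMeasurable g volume →
            (∀ w ∈ W, AEStronglyMeasurable (h w) volume) →
            (∀ᵐ x, ‖f x‖ ≤ F.indicator 1 x) → (∀ᵐ x, ‖g x‖ ≤ G.indicator 1 x) →
            (∀ᵐ x, (∑' w : W, ‖h w x‖ₑ ^ r') ^ (1 / r') ≤ H'.indicator 1 x) →
            ‖BilinearRdF.modelForm S φ f g h‖ ≤
              K p q B C * volume.real F ^ (1 / p) * volume.real G ^ (1 / q) *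
                volume.real H ^ (1 - 1 / s) := by
  choose K hK hbound using fun C : ℝ => exists_modelForm_bound hr hrr' C
  -- Order 1 already gives ten powers of decay, since the weight has exponent -10. The constant
  -- counts the offsets and is uniform in p and q.
  refine ⟨fun _ _ => 1, fun _ _ B C => (Finset.Icc ⌈1 / 2 - B⌉ ⌊1 / 2 + B⌋).card * K C, ?_⟩
  intro F G H hF hG hH hFfin hGfin hHvol
  have hr'0 : 0 < r' := hrr'.symm.pos
  set E := exceptionalSet F ∪ exceptionalSet G with hEdef
  have hE : IsOpen E := (isOpen_exceptionalSet F).union (isOpen_exceptionalSet G)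
  -- Each exceptional set has measure at most 1/5, and 2/5 < 1/2 = |H|/2.
  have hEvol : volume E ≤ ENNReal.ofReal (2 / 5) := by
    refine (measure_union_le _ _).trans ((add_le_add (volume_exceptionalSet_le hF hFfin)
      (volume_exceptionalSet_le hG hGfin)).trans_eq ?_)
    rw [← ENNReal.ofReal_add (by norm_num) (by norm_num)]
    norm_num
  have hne : Eᶜ.Nonempty := by
    rw [Set.nonempty_compl]
    intro h
    rw [h, Real.volume_univ, top_le_iff] at hEvol
    exact ENNReal.ofReal_ne_top hEvol
  have hlarge : volume H / 2 < volume (H \ E) := by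
    have h1 : 1 ≤ volume (H \ E) + ENNReal.ofReal (2 / 5) := by
      calc 1 = volume H := hHvol.symm
        _ ≤ volume (H \ E) + volume E := (measure_mono (Set.subset_sdiff_union H E)).trans
            (measure_union_le _ _)
        _ ≤ _ := by gcongr
    rw [hHvol]
    by_contra! h2
    have h3 : (1 : ℝ≥0∞) ≤ ENNReal.ofReal (9 / 10) := by
      refine h1.trans ((add_le_add_left h2 _).trans_eq ?_)
      rw [show (1 : ℝ≥0∞) / 2 = ENNReal.ofReal (1 / 2) by
        rw [ENNReal.ofReal_div_of_pos (by norm_num)]; simp,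
        ← ENNReal.ofReal_add (by norm_num) (by norm_num)]
      norm_num
    rw [ENNReal.one_le_ofReal] at h3
    norm_num at h3
  refine ⟨H \ E, hH.diff hE.measurableSet, Set.sdiff_subset, hlarge, ?_⟩
  intro p q s hp hq hs hsr hpqs B C W S φ hmod f g h hfm hgm hhm hf hg hh
  have hs0 : 0 < s := by linarith
  have hpq : 1 / r ≤ 1 / p + 1 / q := by
    rw [hpqs]; exact one_div_le_one_div_of_le hs0 hsr.le
  have hh' : ∀ᵐ x, ∑' w : W, ‖h w x‖ₑ ^ r' ≤ (H \ E).indicator 1 x := by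
    filter_upwards [hh] with x hx
    have h1 := ENNReal.rpow_le_rpow hx hr'0.le
    rw [← ENNReal.rpow_mul, one_div_mul_cancel hr'0.ne', ENNReal.rpow_one] at h1
    refine h1.trans_eq ?_
    by_cases hxH : x ∈ H \ E
    · simp [Set.indicator_of_mem hxH]
    · simp [Set.indicator_of_notMem hxH, hr'0]
  have hH1 : volume.real H = 1 := by rw [Measure.real, hHvol, ENNReal.toReal_one]
  rw [hH1, Real.one_rpow, mul_one]
  set T := Finset.Icc ⌈1 / 2 - B⌉ ⌊1 / 2 + B⌋ with hT
  -- The offsets partition the tri-tiles into finitely many classes, to each of which the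
  -- fixed-offset bound applies with the same E.
  have hsplit : modelForm S φ f g h =
      ∑ d ∈ T, modelForm (S.filter fun s => s.thirdOffset = d) φ f g h :=
    (Finset.sum_fiberwise_of_maps_to
      (fun s hs => Tritile.thirdOffset_mem (hmod.third s hs)) _).symm
  rw [hsplit]
  refine (norm_sum_le _ _).trans ?_
  calc _ ≤ ∑ d ∈ T, K C * (volume.real F ^ (1 / p) * volume.real G ^ (1 / q)) :=
        Finset.sum_le_sum fun d _ => hbound C (hmod.mono (Finset.filter_subset _ _))
          (fun s hs => (Finset.mem_filter.1 hs).2) hE hne hF hFfin Set.subset_union_left hG hGfin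
          Set.subset_union_right (hH.diff hE.measurableSet) Set.disjoint_sdiff_left
          ((measure_mono Set.sdiff_subset).trans_eq hHvol) hfm hgm hhm hf hg hh' hp hq hpq
    _ = _ := by
        rw [Finset.sum_const, nsmul_eq_mul]; ring
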